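/- Consider a cache-enabled F-RAN in the plane with the typical user at the origin. F-APs and RRHs form independent homogeneous Poisson point processes of densities $\lambda_F,\lambda_R>0$ and transmit with powers $P_F,P_R>0$. All channels undergo independent Rayleigh fading with power gain $|h|^2\sim\mathrm{Exp}(1)$, and the path loss is $r^{-\alpha}$. Let $r_{x_0},r_{y_0}$ be the distances from the user to the closest F-AP $x_0$ and to the closest RRH $y_0$, and let $k>0$. The user is associated with $x_0$ if $k\,r_{x_0}\le r_{y_0}$ and with $y_0$ otherwise; for $k=(P_R/P_F)^{1/\alpha}$ this is association by maximal reference signal receiving power (RSRP). The SINR, with noise power $\sigma^2$, is $$\gamma^F=\frac{P_F|h_{x_0}|^2r_{x_0}^{-\alpha}}{\sum_{x\ne x_0}P_F|h_x|^2r_x^{-\alpha}+\sum_{y}P_R|h_y|^2r_y^{-\alpha}+\sigma^2},\qquad \gamma^R=\frac{\zeta P_R|h_{y_0}|^2r_{y_0}^{-\alpha}}{\sum_{x}P_F|h_x|^2r_x^{-\alpha}+\upsilon\sum_{y\neq y_0}P_R|h_y|^2r_y^{-\alpha}+\sigma^2},$$ when the user is served by $x_0$ and by $y_0$, respectively, where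 $x$ and $y$ run over the F-APs and the RRHs. Here, for $N_B\ge 2$ antennas and $B\in\{0,1,2,\dots\}$ feedback bits, $\zeta=1-2^B\,\beta\!\left(2^B,\tfrac{N_B}{N_B-1}\right)$ with the Beta function $\beta(x,y)=\Gamma(x)\Gamma(y)/\Gamma(x+y)$, and $\upsilon=2^{-B/(N_B-1)}$. For a threshold $\delta>0$ let $S_F(\delta,\alpha)$ and $S_R(\delta,\alpha)$ be the conditional probabilities that the SINR exceeds $\delta$ given association with an F-AP and with an RRH, respectively, in the interference-limited regime (both with $\sigma^2=0$ and in the limit $\sigma^2\to0^+$). For path-loss exponent $\alpha=4$, $$S_F(\delta,4)=\frac{\lambda_F+k^2\lambda_R}{\lambda_F\left(1+\sqrt{\delta}\left(\frac{\pi}{2}-\arctan\frac{1}{\sqrt{\delta}}\right)\right)+k^2\lambda_R\left(1+\sqrt{\frac{\delta P_R}{k^4P_F}}\left(\frac{\pi}{2}-\arctan\sqrt{\frac{k^4P_F}{\delta P_R}}\right)\right)},$$ $$S_R(\delta,4)=\frac{\lambda_F+k^2\lambda_R}{\lambda_F\left(1+\sqrt{\frac{\delta k^4P_F}{\zeta P_R}}\left(\frac{\pi}{2}-\arctan\sqrt{\frac{\zeta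 P_R}{\delta k^4P_F}}\right)\right)+k^2\lambda_R\left(1+\sqrt{\frac{\upsilon\delta}{\zeta}}\left(\frac{\pi}{2}-\arctan\sqrt{\frac{\zeta}{\upsilon\delta}}\right)\right)}.$$ Equivalently, with $\rho(x,\alpha)=\int_{x^{-2/\alpha}}^\infty \frac{x^{2/\alpha}}{1+u^{\alpha/2}}\,du$, one has $\rho(x,4)=\sqrt{x}\left(\frac{\pi}{2}-\arctan\frac{1}{\sqrt{x}}\right)$ for $x>0$, and the two right-hand sides are the values at $\alpha=4$ of $$\frac{\lambda_F+k^2\lambda_R}{\lambda_F(1+\rho(\delta,\alpha))+k^2\lambda_R\left(1+\rho\left(\frac{\delta P_R}{k^\alpha P_F},\alpha\right)\right)} \quad\text{and}\quad \frac{\lambda_F+k^2\lambda_R}{\lambda_F\left(1+\rho\left(\frac{\delta k^\alpha P_F}{\zeta P_R},\alpha\right)\right)+k^2\lambda_R\left(1+\rho\left(\frac{\upsilon\delta}{\zeta},\alpha\right)\right)}.$$ -/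

import Mathlib

open MeasureTheory ProbabilityTheory Filter Set
open scoped ENNReal NNReal Topology

noncomputable section

/-- The plane in which base stations are deployed; the typical user sits at the origin. -/
abbrev Plane : Type := EuclideanSpace ℝ (Fin 2)

/-- Number of points of the random point sequence `X` that fall in `A`. -/
def pointCount {Ω : Type*} (X : ℕ → Ω → Plane) (A : Set Plane) (ω : Ω) : ℝ≥0∞ :=
  ∑' n, A.indicator (fun _ => (1 : ℝ≥0∞)) (X n ω)

/-- The random points `X 0, X 1, …` enumerate a homogeneous Poisson point process of density
`lam > 0` in the plane: the number of points in a measurable set of finite area is Poisson with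
mean `lam` times the area, and the numbers in disjoint sets are independent. (The process has
infinitely many points almost surely, so that it can be enumerated by `ℕ`.) -/
structure IsHomogeneousPPP {Ω : Type*} [MeasurableSpace Ω] (P : Measure Ω)
    (lam : ℝ) (X : ℕ → Ω → Plane) : Prop where
  measurable : ∀ n, Measurable (X n)
  count_law : ∀ A : Set Plane, MeasurableSet A → volume A ≠ ∞ →
    P.map (pointCount X A) =
      (poissonMeasure (lam.toNNReal * (volume A).toNNReal)).map (fun j : ℕ => (j : ℝ≥0∞))
  count_indep : ∀ (m : ℕ) (A : Fin m → Set Plane), (∀ i, MeasurableSet (A i)) →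
    (∀ i, volume (A i) ≠ ∞) → Pairwise (fun i j => Disjoint (A i) (A j)) →
    iIndepFun (fun i => pointCount X (A i)) P

/-- Positions of the F-APs and of the RRHs, and the small-scale fading coefficients of the
channels from the individual F-APs and RRHs to the typical user. -/
structure Network (Ω : Type*) where
  posF : ℕ → Ω → Plane
  posR : ℕ → Ω → Plane
  chF : ℕ → Ω → ℂ
  chR : ℕ → Ω → ℂ

/-- The two-tier F-RAN: the tiers are independent homogeneous Poisson point processes, the
channels are mutually independent, independent of the positions, and Rayleigh fading, that is,
with power gain `|h|²` exponentially distributed with mean one (as it is for `h ∼ CN(0,1)`). -/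
structure Network.IsFRAN {Ω : Type*} [MeasurableSpace Ω] (N : Network Ω) (P : Measure Ω)
    (lamF lamR : ℝ) : Prop where
  ppp_F : IsHomogeneousPPP P lamF N.posF
  ppp_R : IsHomogeneousPPP P lamR N.posR
  tiers_indep : IndepFun (fun ω n => N.posF n ω) (fun ω n => N.posR n ω) P
  measurable_chF : ∀ n, Measurable (N.chF n)
  measurable_chR : ∀ n, Measurable (N.chR n)
  rayleigh_F : ∀ n, P.map (fun ω => ‖N.chF n ω‖ ^ 2) = expMeasure 1
  rayleigh_R : ∀ n, P.map (fun ω => ‖N.chR n ω‖ ^ 2) = expMeasure 1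
  ch_indep : iIndepFun (Sum.elim N.chF N.chR) P
  pos_ch_indep : IndepFun
    (fun ω => ((fun n => N.posF n ω, fun n => N.posR n ω) : (ℕ → Plane) × (ℕ → Plane)))
    (fun ω => ((fun n => N.chF n ω, fun n => N.chR n ω) : (ℕ → ℂ) × (ℕ → ℂ))) P

/-- Index of the point of the sequence `x` closest to the origin (the least such index; for a
Poisson point process the closest point almost surely exists and is unique). -/
def nearest (x : ℕ → Plane) : ℕ := sInf {n | ∀ m, ‖x n‖ ≤ ‖x m‖}

/-- Received power `p |h|² ‖x‖^(-α)` from a base station at `x` with transmit power `p`. -/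
def rxPower (α p : ℝ) (h : ℂ) (x : Plane) : ℝ≥0∞ :=
  ENNReal.ofReal p * ‖h‖ₑ ^ 2 * ‖x‖ₑ ^ (-α)

namespace Network

variable {Ω : Type*} (N : Network Ω)

/-- Index of the F-AP closest to the typical user. -/
def nearF (ω : Ω) : ℕ := nearest fun n => N.posF n ω

/-- Index of the RRH closest to the typical user. -/
def nearR (ω : Ω) : ℕ := nearest fun n => N.posR n ω

/-- The typical user is associated with the closest F-AP: `k r_x ≤ r_y`, where `r_x` and `r_y`
are the distances to the closest F-AP and to the closest RRH. For `k = (P_R / P_F) ^ (1 / α)`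
this says `P_F r_x ^ (-α) ≥ P_R r_y ^ (-α)`: the closest F-AP has the larger received reference
power. -/
def assocF (k : ℝ) : Set Ω :=
  {ω | k * ‖N.posF (N.nearF ω) ω‖ ≤ ‖N.posR (N.nearR ω) ω‖}

/-- Otherwise the typical user is associated with the closest RRH. -/
def assocR (k : ℝ) : Set Ω := (N.assocF k)ᶜ

/-- SINR at the typical user when it is served by the closest F-AP; `noise` is `σ²`. -/
def sinrF (α PF PR noise : ℝ) (ω : Ω) : ℝ≥0∞ :=
  rxPower α PF (N.chF (N.nearF ω) ω) (N.posF (N.nearF ω) ω) /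
    ((∑' n, if n = N.nearF ω then 0 else rxPower α PF (N.chF n ω) (N.posF n ω))
      + (∑' n, rxPower α PR (N.chR n ω) (N.posR n ω))
      + ENNReal.ofReal noise)

/-- SINR at the typical user when it is served by the closest RRH under limited interference
collaboration, with quantized coefficient `ζ` and interference power coefficient `υ`. -/
def sinrR (α PF PR ζ υ noise : ℝ) (ω : Ω) : ℝ≥0∞ :=
  ENNReal.ofReal ζ * rxPower α PR (N.chR (N.nearR ω) ω) (N.posR (N.nearR ω) ω) /
    ((∑' n, rxPower α PF (N.chF n ω) (N.posF n ω))
      + ENNReal.ofReal υ *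
        (∑' n, if n = N.nearR ω then 0 else rxPower α PR (N.chR n ω) (N.posR n ω))
      + ENNReal.ofReal noise)

variable [MeasurableSpace Ω]

/-- Success delivery probability of the typical user at F-APs: conditional probability that the
SINR exceeds `δ`, given association with an F-AP. -/
def successF (P : Measure Ω) (k α PF PR noise δ : ℝ) : ℝ :=
  (ProbabilityTheory.cond P (N.assocF k)).real
    {ω | ENNReal.ofReal δ < N.sinrF α PF PR noise ω}

/-- Success delivery probability of the typical user at RRHs: conditional probability that the
SINR exceeds `δ`, given association with an RRH. -/
def successR (P : Measure Ω) (k α PF PR ζ υ noise δ : ℝ) : ℝ :=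
  (ProbabilityTheory.cond P (N.assocR k)).real
    {ω | ENNReal.ofReal δ < N.sinrR α PF PR ζ υ noise ω}

end Network

/-- Quantized coefficient `1 - L β(L, N_B / (N_B - 1))`, with codebook size `L = 2 ^ B`, for `B`
feedback bits and `NB` antennas. -/
def quantCoeff (B NB : ℕ) : ℝ :=
  1 - 2 ^ B * ProbabilityTheory.beta (2 ^ B) ((NB : ℝ) / ((NB : ℝ) - 1))

/-- Interference power coefficient `2 ^ (-B / (N_B - 1))`. -/
def interfCoeff (B NB : ℕ) : ℝ := (2 : ℝ) ^ (-((B : ℝ) / ((NB : ℝ) - 1)))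

/-- `ρ(x, α) = ∫_{x^(-2/α)}^∞ x^(2/α) / (1 + u^(α/2)) du`. -/
def rho (x α : ℝ) : ℝ :=
  ∫ u in Ioi (x ^ (-2 / α)), x ^ (2 / α) / (1 + u ^ (α / 2))

/-- The expression for the success delivery probability at F-APs in terms of `ρ`. -/
def rhoFormulaF (lamF lamR k α PF PR δ : ℝ) : ℝ :=
  (lamF + k ^ 2 * lamR) /
    (lamF * (1 + rho δ α) + k ^ 2 * lamR * (1 + rho (δ * PR / (k ^ α * PF)) α))

/-- The expression for the success delivery probability at RRHs in terms of `ρ`. -/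
def rhoFormulaR (lamF lamR k α PF PR ζ υ δ : ℝ) : ℝ :=
  (lamF + k ^ 2 * lamR) /
    (lamF * (1 + rho (δ * k ^ α * PF / (ζ * PR)) α)
      + k ^ 2 * lamR * (1 + rho (υ * δ / ζ) α))

/-- The closed form at F-APs for path-loss exponent four. -/
def closedFormF (lamF lamR k PF PR δ : ℝ) : ℝ :=
  (lamF + k ^ 2 * lamR) /
    (lamF * (1 + √δ * (Real.pi / 2 - Real.arctan (1 / √δ)))
      + k ^ 2 * lamR * (1 + √(δ * PR / (k ^ 4 * PF)) *
          (Real.pi / 2 - Real.arctan √(k ^ 4 * PF / (δ * PR)))))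

/-- The closed form at RRHs for path-loss exponent four. -/
def closedFormR (lamF lamR k PF PR ζ υ δ : ℝ) : ℝ :=
  (lamF + k ^ 2 * lamR) /
    (lamF * (1 + √(δ * k ^ 4 * PF / (ζ * PR)) *
          (Real.pi / 2 - Real.arctan √(ζ * PR / (δ * k ^ 4 * PF))))
      + k ^ 2 * lamR * (1 + √(υ * δ / ζ) *
          (Real.pi / 2 - Real.arctan √(ζ / (υ * δ)))))

end

/-! Fix the positions, and let the user be served by the nearest point of the tier `x`, at squared
distance `t`. With α = 4 and no noise, coverage says that the serving gain exceeds Σ aᵢ|hᵢ|² with aᵢ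
= (s t / uᵢ)², where uᵢ is the squared distance of interferer i and s² is δ times its power over the
serving power. Exponential gains give this the probability ∏ 1/(1 + aᵢ) (`measure_lt_nearestSinr`).
Letting the product run over the serving point as well costs a factor 1/(1 + s²), which is put back
by hand. What remains is a `loss` of each tier at a scale proportional to `t`.

The positions are averaged without Palm calculus. The Laplace functional
(`IsHomogeneousPPP.laplace`), applied to a weight that is infinite near the origin, gives the
expected loss at a fixed scale q on the event that no point is closer than b. These tails determine
the law of the nearest squared distance under the loss-weighted measure
(`map_nearestSq_withDensity`). Splitting over values extends this to scales taking countably many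
values as functions of `t`, and dyadic approximation from below to the scale s t
(`lintegral_nearestSq_mul_loss_scaled`). At that scale the weighted density is exponential in `t`,
with a prefactor 1/(1 + s²) that cancels the correction above.

By independence the other tier, with `t` frozen, contributes another exponential in `t`
(`lintegral_indicator_nearestSq`). One exponential integral then gives the joint probability of
association and coverage, and scale zero gives the probability of association; their quotient is the
closed form. The RRH case is the same statement with the tiers exchanged, k replaced by 1/k, and ζ,
υ absorbed into the powers; this needs ζ > 0, a Gamma function inequality. Vanishing noise is
harmless because for each outcome the coverage event is eventually constant. -/

/-! ### The function `a ↦ exp (-a)` on the extended nonnegative reals -/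

/-- `exp (-a)` for `a ∈ [0, ∞]`. -/
noncomputable def nexp (a : ℝ≥0∞) : ℝ≥0∞ := EReal.exp (-(a : EReal))

@[simp] lemma nexp_zero : nexp 0 = 1 := by simp [nexp]

@[simp] lemma nexp_top : nexp ∞ = 0 := by simp [nexp]

lemma nexp_ofReal {x : ℝ} (hx : 0 ≤ x) : nexp (ENNReal.ofReal x) = ENNReal.ofReal (Real.exp (-x)) := by
  rw [nexp, EReal.coe_ennreal_ofReal, max_eq_left hx, ← EReal.coe_neg, EReal.exp_coe]

lemma nexp_eq_ofReal {a : ℝ≥0∞} (ha : a ≠ ∞) : nexp a = ENNReal.ofReal (Real.exp (-a.toReal)) := by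
  rw [← nexp_ofReal ENNReal.toReal_nonneg, ENNReal.ofReal_toReal ha]

lemma nexp_add (a b : ℝ≥0∞) : nexp (a + b) = nexp a * nexp b := by
  rw [nexp, nexp, nexp, ← EReal.exp_add, EReal.coe_ennreal_add, EReal.neg_add, sub_eq_add_neg]
  · exact Or.inl (EReal.coe_ennreal_ne_bot a)
  · exact Or.inr (EReal.coe_ennreal_ne_bot b)

lemma antitone_nexp : Antitone nexp := fun a b h => by
  simpa [nexp] using h

lemma nexp_le_one (a : ℝ≥0∞) : nexp a ≤ 1 := nexp_zero ▸ antitone_nexp (zero_le : 0 ≤ a)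

lemma nexp_ne_top (a : ℝ≥0∞) : nexp a ≠ ∞ := ne_top_of_le_ne_top ENNReal.one_ne_top (nexp_le_one a)

lemma continuous_nexp : Continuous nexp :=
  ENNReal.continuous_exp.comp (continuous_neg.comp continuous_coe_ennreal_ereal)

@[fun_prop] lemma measurable_nexp : Measurable nexp := continuous_nexp.measurable

lemma nexp_sum {ι : Type*} (s : Finset ι) (a : ι → ℝ≥0∞) :
    nexp (∑ i ∈ s, a i) = ∏ i ∈ s, nexp (a i) := by
  classical
  induction s using Finset.induction_on with
  | empty => simp
  | insert i s hi ih => rw [Finset.sum_insert hi, Finset.prod_insert hi, nexp_add, ih]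

lemma nexp_mul_natCast (a : ℝ≥0∞) (n : ℕ) : nexp (a * n) = nexp a ^ n := by
  induction n with
  | zero => simp
  | succ n ih => rw [Nat.cast_succ, mul_add, mul_one, nexp_add, ih, pow_succ]

lemma nexp_log_one_add {x : ℝ} (hx : 0 ≤ x) :
    nexp (ENNReal.ofReal (Real.log (1 + x))) = ENNReal.ofReal (1 / (1 + x)) := by
  rw [nexp_ofReal (Real.log_nonneg (by linarith)), Real.exp_neg, Real.exp_log (by linarith), one_div]

/-! ### Laplace functional of a Poisson point process -/

/-- This is the Poisson generating function at z = exp(-a). The case a = ∞ is included: z = 0 and ∞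
· 0 = 0, so it yields the void probability. -/
lemma lintegral_nexp_mul_poissonMeasure (r : ℝ≥0) (a : ℝ≥0∞) :
    ∫⁻ j, nexp (a * (j : ℝ≥0∞)) ∂(poissonMeasure r) = nexp (r * (1 - nexp a)) := by
  have hz0 : 0 ≤ (nexp a).toReal := ENNReal.toReal_nonneg
  have hz1 : (nexp a).toReal ≤ 1 := ENNReal.toReal_le_of_le_ofReal zero_le_one (by simpa using nexp_le_one a)
  have hz : nexp a = ENNReal.ofReal (nexp a).toReal := (ENNReal.ofReal_toReal (nexp_ne_top a)).symm
  set z := (nexp a).toReal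
  have hr : (r : ℝ≥0∞) * (1 - nexp a) = ENNReal.ofReal (r * (1 - z)) := by
    rw [hz, ENNReal.ofReal_mul (NNReal.coe_nonneg r), ENNReal.ofReal_sub _ hz0, ENNReal.ofReal_one,
      ENNReal.ofReal_coe_nnreal]
  rw [hr, nexp_ofReal (mul_nonneg (NNReal.coe_nonneg r) (by linarith))]
  simp_rw [nexp_mul_natCast, hz, ← ENNReal.ofReal_pow hz0]
  rw [lintegral_countable']
  simp_rw [poissonMeasure_singleton, ← ENNReal.ofReal_mul (pow_nonneg hz0 _)]
  have hs : HasSum (fun n : ℕ => z ^ n * (Real.exp (-r) * r ^ n / (n.factorial)))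
      (Real.exp (-(r * (1 - z)))) := by
    have h1 := (NormedSpace.expSeries_div_hasSum_exp ((r : ℝ) * z)).mul_left (Real.exp (-r))
    rw [← Real.exp_eq_exp_ℝ, ← Real.exp_add] at h1
    have h2 : Real.exp (-(r * (1 - z))) = Real.exp (-r + r * z) := by ring_nf
    rw [h2]
    refine h1.congr_fun fun n => ?_
    rw [mul_pow]; ring
  rw [← ENNReal.ofReal_tsum_of_nonneg _ hs.summable, hs.tsum_eq]
  intro n
  exact mul_nonneg (pow_nonneg hz0 _) (by positivity)

section Laplace

variable {Ω : Type*} [MeasurableSpace Ω] {P : Measure Ω} {lam : ℝ} {X : ℕ → Ω → Plane}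

lemma measurable_pointCount (hX : ∀ n, Measurable (X n)) {A : Set Plane} (hA : MeasurableSet A) :
    Measurable (pointCount X A) := by
  unfold pointCount
  exact Measurable.tsum fun n => (measurable_const.indicator hA).comp (hX n)

lemma IsHomogeneousPPP.lintegral_nexp_mul_pointCount (hX : IsHomogeneousPPP P lam X)
    {A : Set Plane} (hA : MeasurableSet A) (hA' : volume A ≠ ∞) (a : ℝ≥0∞) :
    ∫⁻ ω, nexp (a * pointCount X A ω) ∂P
      = nexp (ENNReal.ofReal lam * (volume A * (1 - nexp a))) := by
  have hm : Measurable fun y : ℝ≥0∞ => nexp (a * y) := measurable_nexp.comp (measurable_const_mul a)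
  rw [← lintegral_map (f := fun y : ℝ≥0∞ => nexp (a * y)) hm (measurable_pointCount hX.measurable hA),
    hX.count_law A hA hA', lintegral_map hm Measurable.of_discrete, lintegral_nexp_mul_poissonMeasure,
    ENNReal.coe_mul, ENNReal.coe_toNNReal hA', mul_assoc]
  rfl

/-- The sum over the points is Σ a · N(f⁻¹{a}) over the nonzero values a. The level sets are
disjoint and of finite area, so the counts are independent Poisson variables and the expectation
factors. -/
lemma IsHomogeneousPPP.laplace_simpleFunc (hX : IsHomogeneousPPP P lam X)
    (f : SimpleFunc Plane ℝ≥0∞) (hf : ∀ a, a ≠ 0 → volume (f ⁻¹' {a}) ≠ ∞) :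
    ∫⁻ ω, nexp (∑' n, f (X n ω)) ∂P
      = nexp (ENNReal.ofReal lam * ∫⁻ x, (1 - nexp (f x))) := by
  classical
  set s : Finset ℝ≥0∞ := f.range.filter (· ≠ 0) with hs
  have hsum : ∀ ω, ∑' n, f (X n ω) = ∑ a ∈ s, a * pointCount X (f ⁻¹' {a}) ω := by
    intro ω
    simp_rw [pointCount, ← ENNReal.tsum_mul_left]
    rw [← Summable.tsum_finsetSum fun _ _ => ENNReal.summable]
    refine tsum_congr fun n => ?_
    by_cases h0 : f (X n ω) = 0
    · rw [h0, eq_comm]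
      refine Finset.sum_eq_zero fun a ha => ?_
      have : X n ω ∉ f ⁻¹' {a} := by
        simp only [mem_preimage, mem_singleton_iff, h0]
        exact (Finset.mem_filter.1 ha).2.symm
      rw [indicator_of_notMem this, mul_zero]
    · rw [Finset.sum_eq_single (f (X n ω))]
      · simp
      · intro a _ hne
        have : X n ω ∉ f ⁻¹' {a} := by simpa using hne.symm
        rw [indicator_of_notMem this, mul_zero]
      · intro hn
        exact absurd (Finset.mem_filter.2 ⟨SimpleFunc.mem_range_self f _, h0⟩) hn
  have hA : ∀ a, MeasurableSet (f ⁻¹' {a}) := fun a => f.measurableSet_fiber a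
  have hind := hX.count_indep s.card (fun i => f ⁻¹' {(s.equivFin.symm i).1}) (fun i => hA _)
    (fun i => hf _ (Finset.mem_filter.1 (s.equivFin.symm i).2).2) (by
      intro i j hij
      refine Disjoint.preimage _ ?_
      rw [disjoint_singleton]
      exact fun h => hij (s.equivFin.symm.injective (Subtype.ext h)))
  have hind' := hind.comp (fun i (y : ℝ≥0∞) => nexp ((s.equivFin.symm i).1 * y))
    fun i => measurable_nexp.comp (measurable_const_mul _)
  have hprod := lintegral_prod_eq_prod_lintegral_of_indepFun Finset.univ _ hind'
    (fun i => measurable_nexp.comp ((measurable_pointCount hX.measurable (hA _)).const_mul _))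
  have hre : ∀ g : ℝ≥0∞ → ℝ≥0∞, ∏ a ∈ s, g a = ∏ i : Fin s.card, g (s.equivFin.symm i).1 := by
    intro g
    rw [← Finset.prod_coe_sort, ← Equiv.prod_comp s.equivFin.symm]
  have hlin : ∫⁻ x, (1 - nexp (f x)) = ∑ a ∈ s, volume (f ⁻¹' {a}) * (1 - nexp a) := by
    have h1 : ∫⁻ x, (1 - nexp (f x)) = (f.map fun a => 1 - nexp a).lintegral volume := by
      rw [← SimpleFunc.lintegral_eq_lintegral]; rfl
    rw [h1, SimpleFunc.map_lintegral, hs, Finset.sum_filter]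
    refine Finset.sum_congr rfl fun a _ => ?_
    by_cases h : a = 0
    · simp [h]
    · simp [h, mul_comm]
  calc ∫⁻ ω, nexp (∑' n, f (X n ω)) ∂P
      = ∫⁻ ω, ∏ i : Fin s.card, nexp ((s.equivFin.symm i).1 *
          pointCount X (f ⁻¹' {(s.equivFin.symm i).1}) ω) ∂P := by
        refine lintegral_congr fun ω => ?_
        rw [hsum, nexp_sum, hre fun a => nexp (a * pointCount X (f ⁻¹' {a}) ω)]
    _ = ∏ i : Fin s.card, ∫⁻ ω, nexp ((s.equivFin.symm i).1 *
          pointCount X (f ⁻¹' {(s.equivFin.symm i).1}) ω) ∂P := hprod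
    _ = ∏ a ∈ s, nexp (ENNReal.ofReal lam * (volume (f ⁻¹' {a}) * (1 - nexp a))) := by
        rw [hre]
        refine Finset.prod_congr rfl fun i _ => ?_
        exact hX.lintegral_nexp_mul_pointCount (hA _)
          (hf _ (Finset.mem_filter.1 (s.equivFin.symm i).2).2) _
    _ = _ := by rw [← nexp_sum, ← Finset.mul_sum, hlin]

/-- Monotone convergence for the counting measure; infinite sums are allowed. -/
lemma tendsto_nexp_tsum {ι : Type*} {f : ℕ → ι → ℝ≥0∞} {g : ι → ℝ≥0∞}
    (hmono : ∀ i, Monotone fun m => f m i) (hlim : ∀ i, Tendsto (fun m => f m i) atTop (𝓝 (g i))) :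
    Tendsto (fun m => nexp (∑' i, f m i)) atTop (𝓝 (nexp (∑' i, g i))) := by
  refine (continuous_nexp.tendsto _).comp ?_
  let _ : MeasurableSpace ι := ⊤
  simp_rw [← lintegral_count]
  exact lintegral_tendsto_of_tendsto_of_monotone (fun m => measurable_from_top.aemeasurable)
    (ae_of_all _ hmono) (ae_of_all _ hlim)

/-- The Laplace functional of a homogeneous Poisson point process. -/
theorem IsHomogeneousPPP.laplace [IsProbabilityMeasure P] (hX : IsHomogeneousPPP P lam X)
    {v : Plane → ℝ≥0∞} (hv : Measurable v) :
    ∫⁻ ω, nexp (∑' n, v (X n ω)) ∂P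
      = nexp (ENNReal.ofReal lam * ∫⁻ x, (1 - nexp (v x))) := by
  -- Cutting off to a ball of radius m gives the nonzero level sets finite area, as the simple case
  -- requires, and keeps the approximation increasing.
  let f : ℕ → SimpleFunc Plane ℝ≥0∞ := fun m =>
    (SimpleFunc.eapprox v m).restrict (Metric.ball 0 m)
  have hfa : ∀ m x, f m x = (Metric.ball (0 : Plane) m).indicator (SimpleFunc.eapprox v m) x :=
    fun m x => SimpleFunc.restrict_apply _ Metric.isOpen_ball.measurableSet x
  have hmono : ∀ x, Monotone fun m => f m x := by
    intro x m m' h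
    simp only [hfa]
    refine (indicator_le_indicator (SimpleFunc.monotone_eapprox v h x)).trans ?_
    exact indicator_le_indicator_of_subset (Metric.ball_subset_ball (by exact_mod_cast h))
      (fun _ => zero_le) x
  have hlim : ∀ x, Tendsto (fun m => f m x) atTop (𝓝 (v x)) := by
    intro x
    refine (SimpleFunc.tendsto_eapprox hv x).congr' ?_
    obtain ⟨m₀, hm₀⟩ := exists_nat_gt ‖x‖
    filter_upwards [eventually_ge_atTop m₀] with m hm
    rw [hfa, indicator_of_mem]
    rw [mem_ball_zero_iff]
    exact hm₀.trans_le (by exact_mod_cast hm)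
  have hfin : ∀ m a, a ≠ 0 → volume (f m ⁻¹' {a}) ≠ ∞ := by
    intro m a ha
    refine ne_top_of_le_ne_top (measure_ball_lt_top (μ := volume) (x := (0 : Plane)) (r := m)).ne
      (measure_mono ?_)
    intro x hx
    by_contra hx'
    have hx : f m x = a := hx
    rw [hfa, indicator_of_notMem hx'] at hx
    exact ha hx.symm
  have hL : Tendsto (fun m => ∫⁻ ω, nexp (∑' n, f m (X n ω)) ∂P) atTop
      (𝓝 (∫⁻ ω, nexp (∑' n, v (X n ω)) ∂P)) := by
    refine tendsto_lintegral_of_dominated_convergence (fun _ => 1) ?_ ?_ ?_ ?_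
    · exact fun m => measurable_nexp.comp
        (Measurable.tsum fun n => (f m).measurable.comp (hX.measurable n))
    · exact fun m => ae_of_all _ fun ω => nexp_le_one _
    · simp
    · exact ae_of_all _ fun ω => tendsto_nexp_tsum (fun n => hmono _) (fun n => hlim _)
  have hR : Tendsto (fun m => nexp (ENNReal.ofReal lam * ∫⁻ x, (1 - nexp (f m x)))) atTop
      (𝓝 (nexp (ENNReal.ofReal lam * ∫⁻ x, (1 - nexp (v x))))) := by
    refine (continuous_nexp.tendsto _).comp (ENNReal.Tendsto.const_mul ?_ (Or.inr ENNReal.ofReal_ne_top))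
    refine lintegral_tendsto_of_tendsto_of_monotone ?_ (ae_of_all _ ?_) (ae_of_all _ ?_)
    · exact fun m => (measurable_const.sub (measurable_nexp.comp (f m).measurable)).aemeasurable
    · exact fun x m m' h => tsub_le_tsub_left (antitone_nexp (hmono x h)) 1
    · intro x
      exact ENNReal.Tendsto.sub tendsto_const_nhds ((continuous_nexp.tendsto _).comp (hlim x))
        (Or.inl ENNReal.one_ne_top)
  refine tendsto_nhds_unique hL (hR.congr fun m => ?_)
  exact (hX.laplace_simpleFunc (f m) (hfin m)).symm

end Laplace

/-! ### The closest point of a sequence -/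

lemma nearest_spec {x : ℕ → Plane} (h : ∃ n, ∀ m, ‖x n‖ ≤ ‖x m‖) (m : ℕ) :
    ‖x (nearest x)‖ ≤ ‖x m‖ := Nat.sInf_mem (s := {n | ∀ m, ‖x n‖ ≤ ‖x m‖}) h m

lemma measurable_nearest : Measurable nearest := by
  have hS : ∀ n, MeasurableSet {x : ℕ → Plane | ∀ m, ‖x n‖ ≤ ‖x m‖} := fun n => by
    rw [ofPred_forall]
    exact MeasurableSet.iInter fun m => measurableSet_le (by fun_prop) (by fun_prop)
  refine measurable_to_countable' fun n => ?_
  -- The second piece is the default value: if no minimiser exists, `sInf ∅ = 0`.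
  have : nearest ⁻¹' {n} =
      ({x : ℕ → Plane | ∀ m, ‖x n‖ ≤ ‖x m‖} ∩ ⋂ j, ⋂ (_ : j < n), {x | ∀ m, ‖x j‖ ≤ ‖x m‖}ᶜ) ∪
      (⋂ j, {x : ℕ → Plane | ∀ m, ‖x j‖ ≤ ‖x m‖}ᶜ) ∩ {_x | n = 0} := by
    ext x
    simp only [mem_preimage, mem_singleton_iff, mem_union, mem_inter_iff, mem_ofPred_eq, mem_iInter,
      mem_compl_iff]
    set S : Set ℕ := {n | ∀ m, ‖x n‖ ≤ ‖x m‖} with hSdef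
    change sInf S = n ↔ (n ∈ S ∧ ∀ j, j < n → j ∉ S) ∨ (∀ j, j ∉ S) ∧ n = 0
    rcases S.eq_empty_or_nonempty with h | h
    · simp [h, eq_comm]
    · constructor
      · rintro rfl
        exact Or.inl ⟨Nat.sInf_mem h, fun j hj => Nat.notMem_of_lt_sInf hj⟩
      · rintro (⟨h1, h2⟩ | ⟨h1, -⟩)
        · refine le_antisymm (Nat.sInf_le h1) ?_
          by_contra! hlt
          exact h2 _ hlt (Nat.sInf_mem h)
        · obtain ⟨j, hj⟩ := h
          exact absurd hj (h1 j)
  rw [this]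
  exact ((hS n).inter (MeasurableSet.iInter fun j => MeasurableSet.iInter fun _ => (hS j).compl)).union
    ((MeasurableSet.iInter fun j => (hS j).compl).inter (MeasurableSet.const _))

lemma measurable_apply_index {α β : Type*} [MeasurableSpace α] [MeasurableSpace β]
    {f : ℕ → α → β} {i : α → ℕ} (hf : ∀ n, Measurable (f n)) (hi : Measurable i) :
    Measurable fun a => f (i a) a :=
  (measurable_from_prod_countable_right (f := fun p : ℕ × α => f p.1 p.2) hf).comp
    (hi.prodMk measurable_id)

/-- Squared distance from the origin to the closest point of the sequence. -/
noncomputable def nearestSq (x : ℕ → Plane) : ℝ := ‖x (nearest x)‖ ^ 2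

lemma nearestSq_nonneg (x : ℕ → Plane) : 0 ≤ nearestSq x := sq_nonneg _

@[fun_prop] lemma measurable_nearestSq : Measurable nearestSq := by
  have h : Measurable fun x : ℕ → Plane => x (nearest x) :=
    measurable_apply_index (f := fun n (x : ℕ → Plane) => x n) (fun n => measurable_pi_apply n)
      measurable_nearest
  exact h.norm.pow_const 2

section

variable {Ω : Type*} [MeasurableSpace Ω] {P : Measure Ω} {lam : ℝ} {X : ℕ → Ω → Plane}

lemma IsHomogeneousPPP.ae_pointCount_ne_top (hX : IsHomogeneousPPP P lam X)
    {A : Set Plane} (hA : MeasurableSet A) (hA' : volume A ≠ ∞) :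
    ∀ᵐ ω ∂P, pointCount X A ω ≠ ∞ := by
  have h : P.map (pointCount X A) {∞} = 0 := by
    rw [hX.count_law A hA hA', Measure.map_apply Measurable.of_discrete (measurableSet_singleton _)]
    have : (fun j : ℕ => (j : ℝ≥0∞)) ⁻¹' {∞} = ∅ := by ext j; simp
    rw [this, measure_empty]
  rw [Measure.map_apply (measurable_pointCount hX.measurable hA) (measurableSet_singleton _)] at h
  rw [ae_iff]
  simp only [ne_eq, not_not]
  exact h

lemma IsHomogeneousPPP.ae_ne_zero (hX : IsHomogeneousPPP P lam X) :
    ∀ᵐ ω ∂P, ∀ n, X n ω ≠ 0 := by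
  have h : P.map (pointCount X {0}) {0}ᶜ = 0 := by
    rw [hX.count_law {0} (measurableSet_singleton _) (by simp),
      Measure.map_apply Measurable.of_discrete (measurableSet_singleton _).compl]
    have : ((fun j : ℕ => (j : ℝ≥0∞)) ⁻¹' {0}ᶜ) = {0}ᶜ := by ext j; simp
    rw [this, prob_compl_eq_zero_iff (measurableSet_singleton _), poissonMeasure_singleton]
    simp
  rw [Measure.map_apply (measurable_pointCount hX.measurable (measurableSet_singleton _))
    (measurableSet_singleton _).compl] at h
  have h' : ∀ᵐ ω ∂P, pointCount X {0} ω = 0 := by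
    rw [ae_iff]; exact h
  filter_upwards [h'] with ω hω n hn
  rw [pointCount, ENNReal.tsum_eq_zero] at hω
  have := hω n
  rw [hn, indicator_of_mem (mem_singleton _)] at this
  exact one_ne_zero this

/-- Almost surely every ball of integer radius contains `X n ω` for only finitely many n, so the
minimum may be taken in a ball containing `X 0 ω`. -/
lemma IsHomogeneousPPP.ae_exists_nearest (hX : IsHomogeneousPPP P lam X) :
    ∀ᵐ ω ∂P, ∃ n, ∀ m, ‖X n ω‖ ≤ ‖X m ω‖ := by
  have h : ∀ᵐ ω ∂P, ∀ m : ℕ, pointCount X (Metric.ball 0 m) ω ≠ ∞ :=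
    ae_all_iff.2 fun m => hX.ae_pointCount_ne_top Metric.isOpen_ball.measurableSet
      measure_ball_lt_top.ne
  filter_upwards [h] with ω hω
  obtain ⟨M, hM⟩ := exists_nat_gt ‖X 0 ω‖
  have hfin := ENNReal.finite_const_le_of_tsum_ne_top (hω M) one_ne_zero
  have hmem : ∀ n, n ∈ {i | 1 ≤ (Metric.ball (0 : Plane) M).indicator (fun _ => (1 : ℝ≥0∞)) (X i ω)}
      ↔ ‖X n ω‖ < M := by
    intro n
    by_cases h : X n ω ∈ Metric.ball (0 : Plane) M
    · simpa [indicator_of_mem h] using h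
    · simpa [indicator_of_notMem h] using h
  obtain ⟨n, hn, hmin⟩ := exists_min_image _ (fun n => ‖X n ω‖) hfin ⟨0, (hmem 0).2 hM⟩
  refine ⟨n, fun m => ?_⟩
  by_cases hm : ‖X m ω‖ < M
  · exact hmin m ((hmem m).2 hm)
  · exact ((hmem n).1 hn).le.trans (not_lt.1 hm)

end

/-! ### Radial integration in the plane -/

/-- A disc of squared radius b has area πb, so the squared radius turns planar area into a multiple
of length. This is why squared distances are used throughout. -/
lemma map_norm_sq_volume :
    (volume : Measure Plane).map (fun x => ‖x‖ ^ 2)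
      = ENNReal.ofReal Real.pi • (volume.restrict (Ioi (0 : ℝ))) := by
  have hm : Measurable fun x : Plane => ‖x‖ ^ 2 := by fun_prop
  have h1 : ∀ b : ℝ, (volume : Measure Plane).map (fun x => ‖x‖ ^ 2) (Iic b)
      = ENNReal.ofReal Real.pi * ENNReal.ofReal b := by
    intro b
    rw [Measure.map_apply hm measurableSet_Iic]
    rcases lt_or_ge b 0 with hb | hb
    · have : (fun x : Plane => ‖x‖ ^ 2) ⁻¹' Iic b = ∅ := by
        ext x
        simp only [mem_preimage, mem_Iic, mem_empty_iff_false, iff_false, not_le]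
        exact hb.trans_le (sq_nonneg _)
      rw [this, measure_empty, ENNReal.ofReal_of_nonpos hb.le, mul_zero]
    · have : (fun x : Plane => ‖x‖ ^ 2) ⁻¹' Iic b = Metric.closedBall 0 (√b) := by
        ext x
        rw [mem_preimage, mem_Iic, mem_closedBall_zero_iff, Real.le_sqrt (norm_nonneg _) hb]
      rw [this, EuclideanSpace.volume_closedBall_fin_two, ← ENNReal.ofReal_pow (Real.sqrt_nonneg _),
        Real.sq_sqrt hb, mul_comm]
  have h2 : ∀ b : ℝ, (ENNReal.ofReal Real.pi • (volume.restrict (Ioi (0 : ℝ)))) (Iic b)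
      = ENNReal.ofReal Real.pi * ENNReal.ofReal b := by
    intro b
    rw [Measure.smul_apply, Measure.restrict_apply measurableSet_Iic, inter_comm, Ioi_inter_Iic,
      Real.volume_Ioc, sub_zero, smul_eq_mul]
  have hfin : ∀ b : ℝ, ENNReal.ofReal Real.pi * ENNReal.ofReal b ≠ ∞ := fun b =>
    ENNReal.mul_ne_top ENNReal.ofReal_ne_top ENNReal.ofReal_ne_top
  refine Measure.ext_of_Ioc' _ _ (fun a b _ => ?_) (fun a b hab => ?_)
  · exact ne_top_of_le_ne_top (hfin b) (h1 b ▸ measure_mono Ioc_subset_Iic_self)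
  · rw [← Iic_sdiff_Iic, measure_sdiff (Iic_subset_Iic.2 hab.le) nullMeasurableSet_Iic
      (by rw [h1]; exact hfin a), measure_sdiff (Iic_subset_Iic.2 hab.le) nullMeasurableSet_Iic
      (by rw [h2]; exact hfin a), h1, h1, h2, h2]

lemma lintegral_norm_sq {f : ℝ → ℝ≥0∞} (hf : Measurable f) :
    ∫⁻ x : Plane, f (‖x‖ ^ 2) = ENNReal.ofReal Real.pi * ∫⁻ u in Ioi (0 : ℝ), f u := by
  rw [← lintegral_map (f := f) (g := fun x : Plane => ‖x‖ ^ 2) hf (by fun_prop), map_norm_sq_volume,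
    lintegral_smul_measure, smul_eq_mul]

/-! ### Attenuation of the desired signal by the interfering points -/

/-- The tail integral `∫_b^∞ q² / (u² + q²) du`. -/
noncomputable def tailArctan (q b : ℝ) : ℝ := q * (Real.pi / 2 - Real.arctan (b / q))

lemma tailArctan_nonneg {q : ℝ} (hq : 0 ≤ q) (b : ℝ) : 0 ≤ tailArctan q b :=
  mul_nonneg hq (sub_nonneg.2 (Real.arctan_lt_pi_div_two _).le)

lemma hasDerivAt_tailArctan {q : ℝ} {u : ℝ} (hu : 0 < u) :
    HasDerivAt (tailArctan q) (-(q ^ 2 / (u ^ 2 + q ^ 2))) u := by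
  unfold tailArctan
  -- For q = 0 the quotient b / q is a junk value, but the outer factor q makes the function vanish
  -- identically.
  by_cases hq : q = 0
  · subst hq
    simpa using hasDerivAt_const u (0 : ℝ)
  · have h := (((hasDerivAt_id u).div_const q).arctan.const_sub (Real.pi / 2)).const_mul q
    convert! h using 1
    simp only [id]
    field_simp
    ring_nf

lemma continuous_tailArctan (q : ℝ) : Continuous (tailArctan q) := by
  unfold tailArctan
  fun_prop

lemma tendsto_tailArctan {q : ℝ} (hq : 0 ≤ q) : Tendsto (tailArctan q) atTop (𝓝 0) := by
  unfold tailArctan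
  rcases hq.eq_or_lt with rfl | hq
  · simp
  · have h : Tendsto (fun b => Real.arctan (b / q)) atTop (𝓝 (Real.pi / 2)) :=
      (tendsto_nhds_of_tendsto_nhdsWithin Real.tendsto_arctan_atTop).comp
        (tendsto_id.atTop_div_const hq)
    simpa using (h.const_sub (Real.pi / 2)).const_mul q

lemma lintegral_Ioi_tail {q b : ℝ} (hq : 0 ≤ q) (hb : 0 ≤ b) :
    ∫⁻ u in Ioi b, ENNReal.ofReal (q ^ 2 / (u ^ 2 + q ^ 2)) = ENNReal.ofReal (tailArctan q b) := by
  have hd : ∀ u ∈ Ioi b, HasDerivAt (fun u => -tailArctan q u) (q ^ 2 / (u ^ 2 + q ^ 2)) u :=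
    fun u hu => by
      have h := (hasDerivAt_tailArctan (q := q) (hb.trans_lt hu)).neg
      rwa [neg_neg] at h
  have hc : ContinuousWithinAt (fun u => -tailArctan q u) (Ici b) b :=
    (continuous_tailArctan q).neg.continuousWithinAt
  have hpos : ∀ u ∈ Ioi b, 0 ≤ q ^ 2 / (u ^ 2 + q ^ 2) := fun u _ => by positivity
  have hl : Tendsto (fun u => -tailArctan q u) atTop (𝓝 0) := by
    simpa using (tendsto_tailArctan hq).neg
  rw [← ofReal_integral_eq_lintegral_ofReal (integrableOn_Ioi_deriv_of_nonneg hc hd hpos hl)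
    ((ae_restrict_iff' measurableSet_Ioi).2 (ae_of_all _ hpos)),
    integral_Ioi_of_hasDerivAt_of_nonneg hc hd hpos hl]
  simp

/-- The exponent `log (1 + q² / u²)` of the loss factor `1 / (1 + q² / u²)` caused by an interfering
point at squared distance `u`. -/
noncomputable def shot (q u : ℝ) : ℝ≥0∞ := ENNReal.ofReal (Real.log (1 + q ^ 2 / u ^ 2))

@[fun_prop] lemma measurable_shot (q : ℝ) : Measurable (shot q) := by
  unfold shot; fun_prop

lemma measurable_shot_comp {α : Type*} [MeasurableSpace α] {f g : α → ℝ}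
    (hf : Measurable f) (hg : Measurable g) : Measurable fun a => shot (f a) (g a) := by
  unfold shot; fun_prop

lemma nexp_shot (q u : ℝ) : nexp (shot q u) = ENNReal.ofReal (1 / (1 + q ^ 2 / u ^ 2)) :=
  nexp_log_one_add (by positivity)

lemma one_sub_nexp_shot (q : ℝ) {u : ℝ} (hu : 0 < u) :
    1 - nexp (shot q u) = ENNReal.ofReal (q ^ 2 / (u ^ 2 + q ^ 2)) := by
  rw [nexp_shot, ← ENNReal.ofReal_one, ← ENNReal.ofReal_sub _ (by positivity)]
  congr 1
  field_simp
  ring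

section

variable {Ω : Type*} [MeasurableSpace Ω] {P : Measure Ω} [IsProbabilityMeasure P]
  {lam : ℝ} {X : ℕ → Ω → Plane}

open Classical in
/-- Expected loss factor on the event that no point has its squared distance in `S`. -/
lemma IsHomogeneousPPP.lintegral_void_loss (hX : IsHomogeneousPPP P lam X) (hlam : 0 < lam)
    {q b : ℝ} (hq : 0 ≤ q) {S : Set ℝ} (hS : MeasurableSet S) (hS1 : Iio b ⊆ S) (hS2 : S ⊆ Iic b) :
    ∫⁻ ω, (if ∀ n, ‖X n ω‖ ^ 2 ∉ S then nexp (∑' n, shot q (‖X n ω‖ ^ 2)) else 0) ∂P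
      = ENNReal.ofReal (Real.exp (-(lam * Real.pi * (max b 0 + tailArctan q (max b 0))))) := by
  -- Since exp(-∞) = 0, an infinite weight on S encodes the void event, and indicator and loss merge
  -- into a single Laplace functional. In its exponent S contributes its length and the complement
  -- the arctangent tail; whether b lies in S is irrelevant.
  let w : ℝ → ℝ≥0∞ := fun u => if u ∈ S then ∞ else shot q u
  have hw : Measurable w := Measurable.ite hS measurable_const (measurable_shot q)
  have hb : 0 ≤ max b 0 := le_max_right _ _
  have h1 : ∀ ω, (if ∀ n, ‖X n ω‖ ^ 2 ∉ S then nexp (∑' n, shot q (‖X n ω‖ ^ 2)) else 0)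
      = nexp (∑' n, w (‖X n ω‖ ^ 2)) := by
    intro ω
    split_ifs with h
    · congr 1
      exact tsum_congr fun n => (if_neg (h n)).symm
    · push Not at h
      obtain ⟨n, hn⟩ := h
      have : ∑' n, w (‖X n ω‖ ^ 2) = ∞ :=
        ENNReal.tsum_eq_top_of_eq_top ⟨n, if_pos hn⟩
      rw [this, nexp_top]
  have h2 : ∫⁻ u in Ioi (0 : ℝ), (1 - nexp (w u))
      = ENNReal.ofReal (max b 0 + tailArctan q (max b 0)) := by
    rw [← Ioc_union_Ioi_eq_Ioi hb, lintegral_union measurableSet_Ioi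
      (Set.disjoint_left.2 fun u hu hu' => not_lt.2 hu.2 hu'),
      ENNReal.ofReal_add hb (tailArctan_nonneg hq _), ← lintegral_Ioi_tail hq hb]
    congr 1
    · rw [← setLIntegral_congr (Ioo_ae_eq_Ioc (μ := volume) (a := (0 : ℝ)) (b := max b 0)),
        setLIntegral_congr_fun (g := fun _ => 1) measurableSet_Ioo]
      · simp
      · intro u hu
        have hub : u ∈ S := by
          refine hS1 ?_
          have h := hu.2
          rw [lt_max_iff] at h
          exact h.resolve_right (not_lt.2 hu.1.le)
        simp only [w, if_pos hub, nexp_top, tsub_zero]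
    · refine setLIntegral_congr_fun measurableSet_Ioi fun u hu => ?_
      have hub : u ∉ S := fun h => not_lt.2 ((hS2 h).trans (le_max_left b 0)) hu
      simp only [w, if_neg hub]
      exact one_sub_nexp_shot q (hb.trans_lt hu)
  have hw' : Measurable fun u => 1 - nexp (w u) := measurable_const.sub (measurable_nexp.comp hw)
  simp_rw [h1]
  rw [hX.laplace (v := fun x => w (‖x‖ ^ 2)) (hw.comp (by fun_prop)),
    lintegral_norm_sq hw', h2, ← ENNReal.ofReal_mul Real.pi_pos.le,
    ← ENNReal.ofReal_mul hlam.le, nexp_ofReal, mul_assoc]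
  have := tailArctan_nonneg hq (max b 0)
  have := Real.pi_pos
  positivity

end

/-! ### Nearest distance weighted by the loss at a fixed scale -/

/-- Density of the squared distance to the closest point, weighted by the expected loss factor. -/
noncomputable def nearestDensity (lam q u : ℝ) : ℝ :=
  lam * Real.pi * (1 - q ^ 2 / (u ^ 2 + q ^ 2)) *
    Real.exp (-(lam * Real.pi * (u + tailArctan q u)))

lemma measurable_nearestDensity (lam : ℝ) :
    Measurable fun p : ℝ × ℝ => nearestDensity lam p.1 p.2 := by
  unfold nearestDensity tailArctan; fun_prop

section

variable {lam : ℝ}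

lemma one_sub_div_nonneg (q u : ℝ) : 0 ≤ 1 - q ^ 2 / (u ^ 2 + q ^ 2) :=
  sub_nonneg.2 (div_le_one_of_le₀ (by nlinarith [sq_nonneg u]) (by positivity))

lemma nearestDensity_nonneg (hlam : 0 < lam) (q u : ℝ) : 0 ≤ nearestDensity lam q u :=
  mul_nonneg (mul_nonneg (mul_pos hlam Real.pi_pos).le (one_sub_div_nonneg q u)) (Real.exp_pos _).le

lemma nearestDensity_le (hlam : 0 < lam) {q : ℝ} (hq : 0 ≤ q) (u : ℝ) :
    nearestDensity lam q u ≤ lam * Real.pi * Real.exp (-(lam * Real.pi * u)) := by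
  have h := mul_pos hlam Real.pi_pos
  unfold nearestDensity
  have h1 : lam * Real.pi * (1 - q ^ 2 / (u ^ 2 + q ^ 2)) ≤ lam * Real.pi :=
    mul_le_of_le_one_right h.le (sub_le_self _ (by positivity))
  refine mul_le_mul h1 (Real.exp_le_exp.2 (neg_le_neg ?_)) (Real.exp_pos _).le h.le
  exact mul_le_mul_of_nonneg_left (le_add_of_nonneg_right (tailArctan_nonneg hq u)) h.le

/-- The density is by construction minus the derivative of the tail found in `lintegral_void_loss`.
-/
lemma lintegral_Ioi_nearestDensity (hlam : 0 < lam) {q b : ℝ} (hq : 0 ≤ q) (hb : 0 ≤ b) :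
    ∫⁻ u in Ioi b, ENNReal.ofReal (nearestDensity lam q u)
      = ENNReal.ofReal (Real.exp (-(lam * Real.pi * (b + tailArctan q b)))) := by
  have hlp := mul_pos hlam Real.pi_pos
  let F : ℝ → ℝ := fun u => -Real.exp (-(lam * Real.pi * (u + tailArctan q u)))
  have hd : ∀ u ∈ Ioi b, HasDerivAt F (nearestDensity lam q u) u := by
    intro u hu
    have h := (((hasDerivAt_id u).add (hasDerivAt_tailArctan (q := q) (hb.trans_lt hu))).const_mul
      (lam * Real.pi)).neg.exp.neg
    convert! h using 1
    simp only [nearestDensity, Pi.neg_apply, Pi.add_apply, id]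
    ring
  have hc : ContinuousWithinAt F (Ici b) b := by
    have := continuous_tailArctan q
    exact Continuous.continuousWithinAt (by fun_prop)
  have hpos : ∀ u ∈ Ioi b, 0 ≤ nearestDensity lam q u := fun u _ => nearestDensity_nonneg hlam q u
  have hl : Tendsto F atTop (𝓝 0) := by
    have h1 : Tendsto (fun u => lam * Real.pi * (u + tailArctan q u)) atTop atTop :=
      (tendsto_id.atTop_add (tendsto_tailArctan hq)).const_mul_atTop hlp
    simpa [F] using (Real.tendsto_exp_neg_atTop_nhds_zero.comp h1).neg
  rw [← ofReal_integral_eq_lintegral_ofReal (integrableOn_Ioi_deriv_of_nonneg hc hd hpos hl)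
    ((ae_restrict_iff' measurableSet_Ioi).2 (ae_of_all _ hpos)),
    integral_Ioi_of_hasDerivAt_of_nonneg hc hd hpos hl]
  simp [F]

variable {Ω : Type*} [MeasurableSpace Ω] {P : Measure Ω} {X : ℕ → Ω → Plane}

lemma IsHomogeneousPPP.measurable_seq (hX : IsHomogeneousPPP P lam X) :
    Measurable fun ω n => X n ω := measurable_pi_lambda _ hX.measurable

variable [IsProbabilityMeasure P]

/-- Product of the loss factors caused by the points of the sequence `x`. -/
noncomputable def loss (q : ℝ) (x : ℕ → Plane) : ℝ≥0∞ := nexp (∑' n, shot q (‖x n‖ ^ 2))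

lemma measurable_loss_comp {α : Type*} [MeasurableSpace α] {f : α → ℝ} {g : α → ℕ → Plane}
    (hf : Measurable f) (hg : Measurable g) : Measurable fun a => loss (f a) (g a) := by
  have h1 : ∀ n, Measurable fun a => ‖g a n‖ ^ 2 := fun n => by
    have h : Measurable fun a => g a n := measurable_pi_iff.1 hg n
    exact h.norm.pow_const 2
  have h2 : ∀ n, Measurable fun a => shot (f a) (‖g a n‖ ^ 2) := fun n =>
    measurable_shot_comp hf (h1 n)
  have h3 : Measurable fun a => ∑' n, shot (f a) (‖g a n‖ ^ 2) := Measurable.tsum h2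
  exact measurable_nexp.comp h3

lemma le_nearestSq_iff {x : ℕ → Plane} (h : ∃ n, ∀ m, ‖x n‖ ≤ ‖x m‖) (b : ℝ) :
    b ≤ nearestSq x ↔ ∀ n, ‖x n‖ ^ 2 ∉ Iio b := by
  simp only [mem_Iio, not_lt]
  constructor
  · exact fun hb n => hb.trans (by unfold nearestSq; gcongr; exact nearest_spec h n)
  · exact fun hb => hb _

lemma lt_nearestSq_iff {x : ℕ → Plane} (h : ∃ n, ∀ m, ‖x n‖ ≤ ‖x m‖) (b : ℝ) :
    b < nearestSq x ↔ ∀ n, ‖x n‖ ^ 2 ∉ Iic b := by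
  simp only [mem_Iic, not_le]
  constructor
  · exact fun hb n => hb.trans_le (by unfold nearestSq; gcongr; exact nearest_spec h n)
  · exact fun hb => hb _

open Classical in
lemma IsHomogeneousPPP.lintegral_indicator_le_nearestSq (hX : IsHomogeneousPPP P lam X) (hlam : 0 < lam)
    {q : ℝ} (hq : 0 ≤ q) (b : ℝ) :
    ∫⁻ ω, {x | b ≤ nearestSq x}.indicator (loss q) (fun n => X n ω) ∂P
      = ENNReal.ofReal (Real.exp (-(lam * Real.pi * (max b 0 + tailArctan q (max b 0))))) := by
  rw [← hX.lintegral_void_loss hlam hq measurableSet_Iio subset_rfl Iio_subset_Iic_self]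
  refine lintegral_congr_ae ?_
  filter_upwards [hX.ae_exists_nearest] with ω hω
  rw [indicator_apply]
  exact if_congr (le_nearestSq_iff hω b) rfl rfl

open Classical in
lemma IsHomogeneousPPP.lintegral_indicator_lt_nearestSq (hX : IsHomogeneousPPP P lam X) (hlam : 0 < lam)
    {q : ℝ} (hq : 0 ≤ q) (b : ℝ) :
    ∫⁻ ω, {x | b < nearestSq x}.indicator (loss q) (fun n => X n ω) ∂P
      = ENNReal.ofReal (Real.exp (-(lam * Real.pi * (max b 0 + tailArctan q (max b 0))))) := by
  rw [← hX.lintegral_void_loss hlam hq measurableSet_Iic Iio_subset_Iic_self subset_rfl]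
  refine lintegral_congr_ae ?_
  filter_upwards [hX.ae_exists_nearest] with ω hω
  rw [indicator_apply]
  exact if_congr (lt_nearestSq_iff hω b) rfl rfl

/-- Both sides give the same mass to every half-line [b, ∞), and the loss-weighted measure is
finite, so the tails determine it. -/
lemma IsHomogeneousPPP.map_nearestSq_withDensity (hX : IsHomogeneousPPP P lam X) (hlam : 0 < lam)
    {q : ℝ} (hq : 0 ≤ q) :
    (P.withDensity fun ω => loss q fun n => X n ω).map (fun ω => nearestSq fun n => X n ω)
      = (volume.restrict (Ioi 0)).withDensity fun u => ENNReal.ofReal (nearestDensity lam q u) := by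
  have hms := hX.measurable_seq
  have hmt : Measurable fun ω => nearestSq fun n => X n ω := measurable_nearestSq.comp hms
  have hfin : IsFiniteMeasure (P.withDensity fun ω => loss q fun n => X n ω) := by
    refine isFiniteMeasure_withDensity (ne_top_of_le_ne_top ENNReal.one_ne_top ?_)
    calc ∫⁻ ω, loss q (fun n => X n ω) ∂P ≤ ∫⁻ _, 1 ∂P := lintegral_mono fun ω => nexp_le_one _
      _ = 1 := by simp
  refine Measure.ext_of_Ici _ _ fun b => ?_
  rw [Measure.map_apply hmt measurableSet_Ici, withDensity_apply _ (hmt measurableSet_Ici),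
    withDensity_apply _ measurableSet_Ici, ← lintegral_indicator (hmt measurableSet_Ici),
    Measure.restrict_restrict measurableSet_Ici]
  have h1 := hX.lintegral_indicator_le_nearestSq hlam hq b
  have h2 : ∫⁻ u in Ici b ∩ Ioi 0, ENNReal.ofReal (nearestDensity lam q u)
      = ∫⁻ u in Ioi (max b 0), ENNReal.ofReal (nearestDensity lam q u) := by
    refine setLIntegral_congr ?_
    have := (Ioi_ae_eq_Ici (μ := (volume : Measure ℝ)) (a := b)).symm.inter
      (ae_eq_refl (Ioi (0 : ℝ)))
    rwa [Ioi_inter_Ioi] at this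
  rw [h2, lintegral_Ioi_nearestDensity hlam hq (le_max_right _ _), ← h1]
  rfl

lemma IsHomogeneousPPP.lintegral_nearestSq_mul_loss (hX : IsHomogeneousPPP P lam X)
    (hlam : 0 < lam) {q : ℝ} (hq : 0 ≤ q) {g : ℝ → ℝ≥0∞} (hg : Measurable g) :
    ∫⁻ ω, g (nearestSq fun n => X n ω) * loss q (fun n => X n ω) ∂P
      = ∫⁻ u in Ioi 0, g u * ENNReal.ofReal (nearestDensity lam q u) := by
  have hms := hX.measurable_seq
  have hd : Measurable fun u => ENNReal.ofReal (nearestDensity lam q u) :=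
    ((measurable_nearestDensity lam).comp (measurable_const.prodMk measurable_id)).ennreal_ofReal
  have hmt : Measurable fun ω => nearestSq fun n => X n ω := measurable_nearestSq.comp hms
  have hgt : Measurable fun ω => g (nearestSq fun n => X n ω) := hg.comp hmt
  have h := congrArg (fun μ => ∫⁻ u, g u ∂μ) (hX.map_nearestSq_withDensity hlam hq)
  rw [lintegral_map hg hmt,
    lintegral_withDensity_eq_lintegral_mul _ (measurable_loss_comp measurable_const hms)
      hgt,
    lintegral_withDensity_eq_lintegral_mul _ hd hg] at h
  simpa only [Pi.mul_apply, mul_comm] using h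

/-- On each set where the index i is constant the scale is fixed, and the previous identity applies
with g cut off to that set. This stands in for conditioning on the nearest distance. -/
lemma IsHomogeneousPPP.lintegral_nearestSq_mul_loss_of_countable (hX : IsHomogeneousPPP P lam X)
    (hlam : 0 < lam) {g : ℝ → ℝ≥0∞} (hg : Measurable g) {i : ℝ → ℕ} (hi : Measurable i)
    {q : ℕ → ℝ} (hq : ∀ j, 0 ≤ q j) :
    ∫⁻ ω, g (nearestSq fun n => X n ω) *
        loss (q (i (nearestSq fun n => X n ω))) (fun n => X n ω) ∂P
      = ∫⁻ u in Ioi 0, g u * ENNReal.ofReal (nearestDensity lam (q (i u)) u) := by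
  have hms := hX.measurable_seq
  let G : ℕ → ℝ → ℝ≥0∞ := fun j => (i ⁻¹' {j}).indicator g
  have hG : ∀ j, Measurable (G j) := fun j => hg.indicator (hi (measurableSet_singleton j))
  have hsum : ∀ (u : ℝ) (r : ℕ → ℝ≥0∞), g u * r (i u) = ∑' j, G j u * r j := by
    intro u r
    rw [tsum_eq_single (i u)]
    · simp [G]
    · intro j hj
      have : u ∉ i ⁻¹' {j} := by simpa using hj.symm
      simp only [G, indicator_of_notMem this, zero_mul]
  have hd : ∀ j, Measurable fun u => ENNReal.ofReal (nearestDensity lam (q j) u) := fun j =>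
    ((measurable_nearestDensity lam).comp (measurable_const.prodMk measurable_id)).ennreal_ofReal
  calc _ = ∫⁻ ω, ∑' j, G j (nearestSq fun n => X n ω) * loss (q j) (fun n => X n ω) ∂P :=
        lintegral_congr fun ω => hsum _ fun j => loss (q j) fun n => X n ω
    _ = ∑' j, ∫⁻ ω, G j (nearestSq fun n => X n ω) * loss (q j) (fun n => X n ω) ∂P := by
        refine lintegral_tsum fun j => Measurable.aemeasurable ?_
        exact ((hG j).comp (measurable_nearestSq.comp hms)).mul
          (measurable_loss_comp measurable_const hms)
    _ = ∑' j, ∫⁻ u in Ioi 0, G j u * ENNReal.ofReal (nearestDensity lam (q j) u) :=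
        tsum_congr fun j => hX.lintegral_nearestSq_mul_loss hlam (hq j) (hG j)
    _ = ∫⁻ u in Ioi 0, ∑' j, G j u * ENNReal.ofReal (nearestDensity lam (q j) u) :=
        (lintegral_tsum fun j => ((hG j).mul (hd j)).aemeasurable).symm
    _ = _ := lintegral_congr fun u =>
        (hsum u fun j => ENNReal.ofReal (nearestDensity lam (q j) u)).symm

/-! ### Dyadic approximation from below -/

/-- The largest multiple of `2⁻ᵐ` below `t ≥ 0`. -/
noncomputable def dyadicFloor (m : ℕ) (t : ℝ) : ℝ := (⌊2 ^ m * t⌋₊ : ℝ) / 2 ^ m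

lemma monotone_dyadicFloor {t : ℝ} (ht : 0 ≤ t) : Monotone fun m => dyadicFloor m t := by
  refine monotone_nat_of_le_succ fun m => ?_
  unfold dyadicFloor
  rw [div_le_div_iff₀ (by positivity) (by positivity), pow_succ', ← mul_assoc]
  refine mul_le_mul_of_nonneg_right ?_ (by positivity)
  have h : ((⌊2 ^ m * t⌋₊ * 2 : ℕ) : ℝ) ≤ 2 * 2 ^ m * t := by
    push_cast
    have := Nat.floor_le (a := 2 ^ m * t) (by positivity)
    linarith
  exact_mod_cast Nat.le_floor h

lemma tendsto_dyadicFloor {t : ℝ} (ht : 0 ≤ t) :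
    Tendsto (fun m => dyadicFloor m t) atTop (𝓝 t) := by
  have h1 : Tendsto (fun m : ℕ => t - (1 / 2 : ℝ) ^ m) atTop (𝓝 t) := by
    simpa using (tendsto_pow_atTop_nhds_zero_of_lt_one (r := (1 / 2 : ℝ)) (by norm_num)
      (by norm_num)).const_sub t
  refine tendsto_of_tendsto_of_tendsto_of_le_of_le h1 tendsto_const_nhds (fun m => ?_) fun m => ?_
  · have h := Nat.lt_floor_add_one (2 ^ m * t)
    have h2 : (0 : ℝ) < 2 ^ m := by positivity
    simp only [dyadicFloor]
    rw [le_div_iff₀ h2, sub_mul, ← mul_pow]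
    norm_num
    linarith
  · simp only [dyadicFloor]
    rw [div_le_iff₀ (by positivity), mul_comm]
    exact Nat.floor_le (by positivity)

lemma dyadicFloor_nonneg (m : ℕ) (t : ℝ) : 0 ≤ dyadicFloor m t := by
  unfold dyadicFloor; positivity

/-! ### Scale proportional to the nearest squared distance -/

/-- The value of `√x (π / 2 - arctan (1 / √x))` at `x = s²`. -/
noncomputable def tailCoeff (s : ℝ) : ℝ := s * (Real.pi / 2 - Real.arctan (1 / s))

lemma tailCoeff_nonneg {s : ℝ} (hs : 0 ≤ s) : 0 ≤ tailCoeff s := tailArctan_nonneg hs 1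

lemma tailArctan_mul (s : ℝ) {u : ℝ} (hu : 0 < u) : tailArctan (s * u) u = u * tailCoeff s := by
  have : u / (s * u) = 1 / s := by field_simp
  rw [tailArctan, tailCoeff, this]
  ring

/-- When q/u is constant, the rational factor is constant and the tail is linear in u, so the
density becomes exponential. -/
lemma nearestDensity_mul (lam : ℝ) {s u : ℝ} (hu : 0 < u) :
    nearestDensity lam (s * u) u
      = lam * Real.pi / (1 + s ^ 2) * Real.exp (-(lam * Real.pi * (1 + tailCoeff s) * u)) := by
  rw [nearestDensity, tailArctan_mul s hu]
  have h1 : 1 - (s * u) ^ 2 / (u ^ 2 + (s * u) ^ 2) = 1 / (1 + s ^ 2) := by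
    have : (1 + s ^ 2) ≠ 0 := by positivity
    have : u ^ 2 + (s * u) ^ 2 ≠ 0 := by positivity
    field_simp
    ring
  rw [h1]
  ring_nf

/-- Increasing scales make every summand increase, so no domination of the infinite sum is needed.
Hence the dyadic approximation from below. -/
lemma tendsto_loss {q : ℕ → ℝ} {q' : ℝ} (h0 : ∀ m, 0 ≤ q m) (hq : Monotone q)
    (hlim : Tendsto q atTop (𝓝 q')) (x : ℕ → Plane) :
    Tendsto (fun m => loss (q m) x) atTop (𝓝 (loss q' x)) := by
  refine tendsto_nexp_tsum (fun n m m' h => ?_) (fun n => ?_)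
  · refine ENNReal.ofReal_le_ofReal (Real.log_le_log (by positivity) ?_)
    have := h0 m
    have := hq h
    gcongr
  · refine (ENNReal.continuous_ofReal.tendsto _).comp ?_
    refine (Real.continuousAt_log (by positivity)).tendsto.comp ?_
    exact ((hlim.pow 2).div_const _).const_add 1

lemma tendsto_nearestDensity {q : ℕ → ℝ} {s u : ℝ} (hs : 0 < s) (hu : 0 < u)
    (hlim : Tendsto q atTop (𝓝 (s * u))) :
    Tendsto (fun m => nearestDensity lam (q m) u) atTop (𝓝 (nearestDensity lam (s * u) u)) := by
  have hc : ContinuousAt (fun q => nearestDensity lam q u) (s * u) := by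
    have h1 : s * u ≠ 0 := by positivity
    have h2 : u ^ 2 + (s * u) ^ 2 ≠ 0 := by positivity
    unfold nearestDensity tailArctan
    fun_prop (disch := assumption)
  exact hc.tendsto.comp hlim

/-- Joint expectation of a function of the closest point and of the loss factors, at a scale
proportional to the squared distance of the closest point. -/
theorem IsHomogeneousPPP.lintegral_nearestSq_mul_loss_scaled (hX : IsHomogeneousPPP P lam X)
    (hlam : 0 < lam) {g : ℝ → ℝ≥0∞} (hg : Measurable g) (hg1 : ∀ u, g u ≤ 1) {s : ℝ} (hs : 0 ≤ s) :
    ∫⁻ ω, g (nearestSq fun n => X n ω) *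
        loss (s * nearestSq fun n => X n ω) (fun n => X n ω) ∂P
      = ∫⁻ u in Ioi 0, g u * ENNReal.ofReal (nearestDensity lam (s * u) u) := by
  rcases hs.eq_or_lt with rfl | hs'
  · simpa using hX.lintegral_nearestSq_mul_loss hlam le_rfl hg
  have hms := hX.measurable_seq
  have hmt : Measurable fun ω => nearestSq fun n => X n ω := measurable_nearestSq.comp hms
  have hmd : ∀ m, Measurable (dyadicFloor m) := fun m => by
    unfold dyadicFloor
    exact (measurable_from_top.comp (Nat.measurable_floor.comp (measurable_const_mul _))).div_const _
  have hgt : ∀ u, g u ≠ ∞ := fun u => ne_top_of_le_ne_top ENNReal.one_ne_top (hg1 u)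
  have hL : Tendsto (fun m => ∫⁻ ω, g (nearestSq fun n => X n ω) *
        loss (s * dyadicFloor m (nearestSq fun n => X n ω)) (fun n => X n ω) ∂P) atTop
      (𝓝 (∫⁻ ω, g (nearestSq fun n => X n ω) *
        loss (s * nearestSq fun n => X n ω) (fun n => X n ω) ∂P)) := by
    refine tendsto_lintegral_of_dominated_convergence (fun _ => 1) (fun m => ?_) (fun m => ?_) ?_ ?_
    · have := (hmd m).comp hmt
      exact (hg.comp hmt).mul (measurable_loss_comp (this.const_mul s) hms)
    · exact ae_of_all _ fun ω => mul_le_one' (hg1 _) (nexp_le_one _)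
    · simp
    · refine ae_of_all _ fun ω => ENNReal.Tendsto.const_mul ?_ (Or.inr (hgt _))
      have ht : 0 ≤ nearestSq fun n => X n ω := nearestSq_nonneg _
      exact tendsto_loss (fun m => mul_nonneg hs (dyadicFloor_nonneg _ _))
        (fun m m' h => mul_le_mul_of_nonneg_left (monotone_dyadicFloor ht h) hs)
        ((tendsto_dyadicFloor ht).const_mul s) _
  have hR : Tendsto (fun m => ∫⁻ u in Ioi 0,
        g u * ENNReal.ofReal (nearestDensity lam (s * dyadicFloor m u) u)) atTop
      (𝓝 (∫⁻ u in Ioi 0, g u * ENNReal.ofReal (nearestDensity lam (s * u) u))) := by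
    -- The density at scale 0, the unweighted law of the nearest squared distance, dominates all the
    -- others.
    refine tendsto_lintegral_of_dominated_convergence
      (fun u => ENNReal.ofReal (nearestDensity lam 0 u)) (fun m => ?_) (fun m => ?_) ?_ ?_
    · exact hg.mul ((measurable_nearestDensity lam).comp
        (((hmd m).const_mul s).prodMk measurable_id)).ennreal_ofReal
    · refine ae_of_all _ fun u => ?_
      refine (mul_le_of_le_one_left' (hg1 u)).trans (ENNReal.ofReal_le_ofReal ?_)
      refine (nearestDensity_le hlam (mul_nonneg hs (dyadicFloor_nonneg _ _)) u).trans_eq ?_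
      simp [nearestDensity, tailArctan]
    · rw [lintegral_Ioi_nearestDensity hlam le_rfl le_rfl]
      exact ENNReal.ofReal_ne_top
    · refine (ae_restrict_iff' measurableSet_Ioi).2 (ae_of_all _ fun u hu => ?_)
      refine ENNReal.Tendsto.const_mul ?_ (Or.inr (hgt _))
      exact (ENNReal.continuous_ofReal.tendsto _).comp
        (tendsto_nearestDensity hs' hu ((tendsto_dyadicFloor (le_of_lt hu)).const_mul s))
  refine tendsto_nhds_unique hL (hR.congr fun m => ?_)
  exact (hX.lintegral_nearestSq_mul_loss_of_countable hlam hg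
    (i := fun t => ⌊2 ^ m * t⌋₊) (Nat.measurable_floor.comp (measurable_const_mul _))
    (q := fun j => s * (j / 2 ^ m)) (fun j => by positivity)).symm

theorem IsHomogeneousPPP.lintegral_exp_nearestSq_mul_loss (hX : IsHomogeneousPPP P lam X)
    (hlam : 0 < lam) {s θ : ℝ} (hs : 0 ≤ s) (hθ : 0 ≤ θ) :
    ∫⁻ ω, ENNReal.ofReal (Real.exp (-(θ * nearestSq fun n => X n ω))) *
        loss (s * nearestSq fun n => X n ω) (fun n => X n ω) ∂P
      = ENNReal.ofReal
          (lam * Real.pi / ((1 + s ^ 2) * (lam * Real.pi * (1 + tailCoeff s) + θ))) := by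
  have hlp := mul_pos hlam Real.pi_pos
  have hR := tailCoeff_nonneg hs
  have key := hX.lintegral_nearestSq_mul_loss_scaled hlam
    -- Truncating at 0 bounds the weight by 1 on the whole line and changes nothing at nonnegative
    -- squared distances.
    (g := fun u => ENNReal.ofReal (Real.exp (-(θ * max u 0)))) (by fun_prop)
    (fun u => by simpa using mul_nonneg hθ (le_max_right u 0)) hs
  have hmax : ∀ x : ℕ → Plane, max (nearestSq x) 0 = nearestSq x := fun x =>
    max_eq_left (nearestSq_nonneg x)
  simp only [hmax] at key
  rw [key]
  set A := lam * Real.pi * (1 + tailCoeff s) + θ with hA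
  have hApos : 0 < A := by positivity
  have hfun : ∀ u ∈ Ioi (0 : ℝ), ENNReal.ofReal (Real.exp (-(θ * max u 0))) *
      ENNReal.ofReal (nearestDensity lam (s * u) u)
      = ENNReal.ofReal (lam * Real.pi / (1 + s ^ 2) * Real.exp (-A * u)) := by
    intro u hu
    have hu : 0 < u := hu
    rw [← ENNReal.ofReal_mul (Real.exp_pos _).le, nearestDensity_mul lam hu, max_eq_left hu.le,
      mul_left_comm, ← Real.exp_add]
    congr 3
    rw [hA]; ring
  rw [setLIntegral_congr_fun measurableSet_Ioi hfun, ← ofReal_integral_eq_lintegral_ofReal,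
    integral_const_mul, integral_exp_mul_Ioi (neg_lt_zero.2 hApos)]
  · congr 1
    simp
    field_simp
  · exact (integrableOn_exp_mul_Ioi (neg_lt_zero.2 hApos) 0).const_mul _
  · exact ae_of_all _ fun u => by positivity

end

/-! ### Rayleigh fading -/

/-- Tonelli for the product law. It serves as conditioning: it freezes the interference, one tier,
or all positions. -/
lemma ProbabilityTheory.IndepFun.lintegral_comp_prod {Ω β γ : Type*} [MeasurableSpace Ω]
    [MeasurableSpace β] [MeasurableSpace γ] {P : Measure Ω} [IsProbabilityMeasure P] {U : Ω → β}
    {V : Ω → γ} (h : IndepFun U V P) (hU : Measurable U) (hV : Measurable V) {f : β → γ → ℝ≥0∞}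
    (hf : Measurable (Function.uncurry f)) :
    ∫⁻ ω, f (U ω) (V ω) ∂P = ∫⁻ ω, ∫⁻ ω', f (U ω) (V ω') ∂P ∂P := by
  have hUV := (indepFun_iff_map_prod_eq_prod_map_map hU.aemeasurable hV.aemeasurable).1 h
  have := Measure.isProbabilityMeasure_map (μ := P) hV.aemeasurable
  calc ∫⁻ ω, f (U ω) (V ω) ∂P
      = ∫⁻ p, Function.uncurry f p ∂(P.map fun ω => (U ω, V ω)) :=
        (lintegral_map hf (hU.prodMk hV)).symm
    _ = ∫⁻ u, ∫⁻ v, f u v ∂(P.map V) ∂(P.map U) := by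
        rw [hUV, lintegral_prod _ hf.aemeasurable]; rfl
    _ = ∫⁻ ω, ∫⁻ v, f (U ω) v ∂(P.map V) ∂P := lintegral_map hf.lintegral_prod_right' hU
    _ = _ := lintegral_congr fun ω => lintegral_map (hf.comp measurable_prodMk_left) hV

lemma expMeasure_one_setOf_lt_ofReal (t : ℝ≥0∞) :
    expMeasure 1 {x | t < ENNReal.ofReal x} = nexp t := by
  have := isProbabilityMeasure_expMeasure one_pos
  by_cases ht : t = ∞
  · simp [ht]
  · have hs : {x : ℝ | t < ENNReal.ofReal x} = (Iic t.toReal)ᶜ := by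
      ext x
      rw [mem_ofPred_eq, compl_Iic, mem_Ioi, ENNReal.lt_ofReal_iff_toReal_lt ht]
    have h := cdf_expMeasure_eq one_pos t.toReal
    rw [if_pos ENNReal.toReal_nonneg, cdf_eq_real, one_mul] at h
    rw [hs, ← ofReal_measureReal, probReal_compl_eq_one_sub measurableSet_Iic, h, sub_sub_cancel,
      nexp_eq_ofReal ht]

lemma lintegral_nexp_mul_expMeasure_one {a : ℝ} (ha : 0 ≤ a) :
    ∫⁻ x, nexp (ENNReal.ofReal a * ENNReal.ofReal x) ∂(expMeasure 1)
      = nexp (ENNReal.ofReal (Real.log (1 + a))) := by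
  have ha1 : -(1 + a) < 0 := by linarith
  have hm : Measurable fun x => nexp (ENNReal.ofReal a * ENNReal.ofReal x) :=
    measurable_nexp.comp (by fun_prop)
  have hpdf : Measurable (exponentialPDF 1) := (measurable_exponentialPDFReal 1).ennreal_ofReal
  have h1 : ∀ x : ℝ, exponentialPDF 1 x * nexp (ENNReal.ofReal a * ENNReal.ofReal x)
      = (Ici (0 : ℝ)).indicator (fun x => ENNReal.ofReal (Real.exp (-(1 + a) * x))) x := by
    intro x
    rcases lt_or_ge x 0 with hx | hx
    · rw [exponentialPDF_of_neg hx, zero_mul, indicator_of_notMem (by simpa using hx)]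
    · rw [exponentialPDF_of_nonneg hx, indicator_of_mem (show x ∈ Ici 0 from hx),
        ← ENNReal.ofReal_mul ha, nexp_ofReal (mul_nonneg ha hx),
        ← ENNReal.ofReal_mul (by positivity), one_mul, one_mul, ← Real.exp_add]
      ring_nf
  have h2 : expMeasure 1 = volume.withDensity (exponentialPDF 1) := rfl
  rw [h2, lintegral_withDensity_eq_lintegral_mul _ hpdf hm]
  simp only [Pi.mul_apply, h1]
  rw [lintegral_indicator measurableSet_Ici, setLIntegral_congr Ioi_ae_eq_Ici.symm,
    ← ofReal_integral_eq_lintegral_ofReal (integrableOn_exp_mul_Ioi ha1 0)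
      (ae_of_all _ fun x => (Real.exp_pos _).le), integral_exp_mul_Ioi ha1, nexp_log_one_add ha]
  congr 1
  rw [mul_zero, Real.exp_zero, neg_div_neg_eq]

section

variable {Ω : Type*} [MeasurableSpace Ω] {P : Measure Ω}

lemma enorm_sq_eq_ofReal (z : ℂ) : ‖z‖ₑ ^ 2 = ENNReal.ofReal (‖z‖ ^ 2) := by
  rw [ENNReal.ofReal_pow (norm_nonneg z), ofReal_norm]

lemma lintegral_comp_gain {h : Ω → ℂ} (hm : Measurable h)
    (hray : P.map (fun ω => ‖h ω‖ ^ 2) = expMeasure 1) {f : ℝ≥0∞ → ℝ≥0∞} (hf : Measurable f) :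
    ∫⁻ ω, f (‖h ω‖ₑ ^ 2) ∂P = ∫⁻ x, f (ENNReal.ofReal x) ∂(expMeasure 1) := by
  have hf' : Measurable fun x => f (ENNReal.ofReal x) := hf.comp ENNReal.measurable_ofReal
  rw [← hray, lintegral_map hf' (by fun_prop)]
  simp_rw [enorm_sq_eq_ofReal]

variable [IsProbabilityMeasure P] {ι : Type*} {c : ι → Ω → ℂ}

/-- Laplace transform of the aggregate of independent exponentially distributed interferers. -/
lemma lintegral_nexp_tsum_gain [Countable ι] (hm : ∀ i, Measurable (c i)) (hind : iIndepFun c P)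
    (hray : ∀ i, P.map (fun ω => ‖c i ω‖ ^ 2) = expMeasure 1) {a : ι → ℝ} (ha : ∀ i, 0 ≤ a i) :
    ∫⁻ ω, nexp (∑' i, ENNReal.ofReal (a i) * ‖c i ω‖ₑ ^ 2) ∂P
      = nexp (∑' i, ENNReal.ofReal (Real.log (1 + a i))) := by
  have hg : ∀ i, Measurable fun z : ℂ => nexp (ENNReal.ofReal (a i) * ‖z‖ₑ ^ 2) := fun i =>
    measurable_nexp.comp (by fun_prop)
  -- Independence factors only finite partial sums; dominated convergence along finite sets gives
  -- the full sum.
  have hL : Tendsto (fun s : Finset ι => ∫⁻ ω, nexp (∑ i ∈ s, ENNReal.ofReal (a i) * ‖c i ω‖ₑ ^ 2) ∂P)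
      atTop (𝓝 (∫⁻ ω, nexp (∑' i, ENNReal.ofReal (a i) * ‖c i ω‖ₑ ^ 2) ∂P)) := by
    refine tendsto_lintegral_filter_of_dominated_convergence (fun _ => 1) ?_ ?_ (by simp) ?_
    · exact Eventually.of_forall fun s => measurable_nexp.comp
        (Finset.measurable_fun_sum s fun i _ => by have := hm i; fun_prop)
    · exact Eventually.of_forall fun s => ae_of_all _ fun ω => nexp_le_one _
    · exact ae_of_all _ fun ω => (continuous_nexp.tendsto _).comp ENNReal.summable.hasSum
  have hR : Tendsto (fun s : Finset ι => nexp (∑ i ∈ s, ENNReal.ofReal (Real.log (1 + a i))))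
      atTop (𝓝 (nexp (∑' i, ENNReal.ofReal (Real.log (1 + a i))))) :=
    (continuous_nexp.tendsto _).comp ENNReal.summable.hasSum
  refine tendsto_nhds_unique hL (hR.congr fun s => ?_)
  have h := lintegral_prod_eq_prod_lintegral_of_indepFun s _ (hind.comp _ hg)
    fun i => (hg i).comp (hm i)
  simp_rw [nexp_sum]
  rw [show ∫⁻ ω, ∏ i ∈ s, nexp (ENNReal.ofReal (a i) * ‖c i ω‖ₑ ^ 2) ∂P
    = ∏ i ∈ s, ∫⁻ ω, nexp (ENNReal.ofReal (a i) * ‖c i ω‖ₑ ^ 2) ∂P from h]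
  refine Finset.prod_congr rfl fun i _ => ?_
  rw [← lintegral_nexp_mul_expMeasure_one (ha i)]
  have hf : Measurable fun y : ℝ≥0∞ => nexp (ENNReal.ofReal (a i) * y) :=
    measurable_nexp.comp (by fun_prop)
  exact (lintegral_comp_gain (hm i) (hray i) hf).symm

lemma measurable_ennreal_tsum {α : Type*} {m : MeasurableSpace α} [Countable ι] {f : ι → α → ℝ≥0∞}
    (h : ∀ i, Measurable (f i)) : Measurable fun x => ∑' i, f i x :=
  Measurable.tsum h

/-- Probability that an exponentially distributed signal exceeds the aggregate interference. -/
theorem measure_tsum_gain_lt [Countable ι] (hm : ∀ i, Measurable (c i)) (hind : iIndepFun c P)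
    (hray : ∀ i, P.map (fun ω => ‖c i ω‖ ^ 2) = expMeasure 1) {a : ι → ℝ} (ha : ∀ i, 0 ≤ a i)
    {i₀ : ι} (h₀ : a i₀ = 0) :
    P {ω | ∑' i, ENNReal.ofReal (a i) * ‖c i ω‖ₑ ^ 2 < ‖c i₀ ω‖ₑ ^ 2}
      = nexp (∑' i, ENNReal.ofReal (Real.log (1 + a i))) := by
  let S : Ω → ℝ≥0∞ := fun ω => ∑' i, ENNReal.ofReal (a i) * ‖c i ω‖ₑ ^ 2
  have hSm : Measurable S := Measurable.tsum fun i => by have := hm i; fun_prop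
  have hGm : Measurable fun ω => ‖c i₀ ω‖ₑ ^ 2 := by have := hm i₀; fun_prop
  have hle : ∀ i, MeasurableSpace.comap (c i) inferInstance ≤ ‹MeasurableSpace Ω› :=
    fun i => (hm i).comap_le
  -- Because `a i₀ = 0`, the sum is measurable with respect to the channels other than i₀.
  have hindep : IndepFun S (c i₀) P := by
    have h := indep_iSup_of_disjoint hle hind (S := {i₀}ᶜ) (T := {i₀}) disjoint_compl_left
    refine indep_of_indep_of_le_right (indep_of_indep_of_le_left h ?_) ?_
    · refine Measurable.comap_le ?_
      refine measurable_ennreal_tsum (m := ⨆ i ∈ ({i₀}ᶜ : Set ι), _) fun i => ?_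
      by_cases hi : i = i₀
      · simp only [hi, h₀, ENNReal.ofReal_zero, zero_mul]
        exact measurable_const
      · have h1 : Measurable[⨆ i ∈ ({i₀}ᶜ : Set ι), MeasurableSpace.comap (c i) inferInstance] (c i) :=
          (comap_measurable (c i)).mono
            (le_iSup₂_of_le (f := fun i (_ : i ∈ ({i₀}ᶜ : Set ι)) =>
              MeasurableSpace.comap (c i) inferInstance) i hi le_rfl) le_rfl
        have h2 : Measurable fun z : ℂ => ENNReal.ofReal (a i) * ‖z‖ₑ ^ 2 := by fun_prop
        exact h2.comp h1
    · exact le_iSup₂_of_le (f := fun i (_ : i ∈ ({i₀} : Set ι)) =>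
              MeasurableSpace.comap (c i) inferInstance) i₀ rfl le_rfl
  let f : ℝ≥0∞ → ℂ → ℝ≥0∞ := fun s z => {p : ℝ≥0∞ × ℂ | p.1 < ‖p.2‖ₑ ^ 2}.indicator 1 (s, z)
  have hf : Measurable (Function.uncurry f) :=
    measurable_one.indicator (measurableSet_lt measurable_fst (by fun_prop))
  have h1 := hindep.lintegral_comp_prod hSm (hm i₀) hf
  have h2 : ∫⁻ ω, f (S ω) (c i₀ ω) ∂P = P {ω | S ω < ‖c i₀ ω‖ₑ ^ 2} := by
    rw [← lintegral_indicator_one (measurableSet_lt hSm hGm)]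
    rfl
  have h3 : ∀ s, ∫⁻ ω, f s (c i₀ ω) ∂P = nexp s := by
    intro s
    have hs : Measurable ({y : ℝ≥0∞ | s < y}.indicator (1 : ℝ≥0∞ → ℝ≥0∞)) :=
      measurable_one.indicator measurableSet_Ioi
    have h4 := lintegral_comp_gain (hm i₀) (hray i₀) hs
    rw [← expMeasure_one_setOf_lt_ofReal s, ← lintegral_indicator_one
      (measurableSet_lt measurable_const ENNReal.measurable_ofReal)]
    exact h4
  change P {ω | S ω < ‖c i₀ ω‖ₑ ^ 2} = _
  rw [← h2, h1]
  simp_rw [h3]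
  exact lintegral_nexp_tsum_gain hm hind hray ha

end

/-! ### Combining the two tiers -/

lemma loss_ne_top (q : ℝ) (x : ℕ → Plane) : loss q x ≠ ∞ := nexp_ne_top _

lemma loss_zero (x : ℕ → Plane) : loss 0 x = 1 := by simp [loss, shot]

section

variable {Ω : Type*} [MeasurableSpace Ω] {P : Measure Ω}
  {lam lam' : ℝ} {X Y : ℕ → Ω → Plane}

lemma IsHomogeneousPPP.ae_nearestSq_pos (hX : IsHomogeneousPPP P lam X) :
    ∀ᵐ ω ∂P, 0 < nearestSq fun n => X n ω := by
  filter_upwards [hX.ae_ne_zero] with ω hω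
  exact pow_pos (norm_pos_iff.2 (hω _)) 2

variable [IsProbabilityMeasure P]

lemma IsHomogeneousPPP.lintegral_indicator_nearestSq (hY : IsHomogeneousPPP P lam' Y)
    (hlam' : 0 < lam') {A : Set (ℝ × ℝ)} (hA : A = {p | p.1 ≤ p.2} ∨ A = {p | p.1 < p.2})
    {κ s t : ℝ} (hκ : 0 < κ) (hs : 0 ≤ s) (ht : 0 < t) :
    ∫⁻ ω, {y | (κ ^ 2 * t, nearestSq y) ∈ A}.indicator (loss (s * t)) (fun n => Y n ω) ∂P
      = ENNReal.ofReal
          (Real.exp (-(lam' * Real.pi * (κ ^ 2 * (1 + tailCoeff (s / κ ^ 2))) * t))) := by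
  have hu : 0 < κ ^ 2 * t := by positivity
  have h : ∫⁻ ω, {y | (κ ^ 2 * t, nearestSq y) ∈ A}.indicator (loss (s * t)) (fun n => Y n ω) ∂P
      = ENNReal.ofReal (Real.exp (-(lam' * Real.pi *
          (max (κ ^ 2 * t) 0 + tailArctan (s * t) (max (κ ^ 2 * t) 0))))) := by
    rcases hA with rfl | rfl
    · exact hY.lintegral_indicator_le_nearestSq hlam' (by positivity) _
    · exact hY.lintegral_indicator_lt_nearestSq hlam' (by positivity) _
  -- The second tier is void up to κ²t, so the scale is measured relative to that bound; the
  -- exponent is then linear in t.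
  have h2 : s * t = s / κ ^ 2 * (κ ^ 2 * t) := by field_simp
  rw [h, max_eq_left hu.le, h2, tailArctan_mul _ hu]
  ring_nf

open Classical in
/-- Expected loss factors of both tiers on the event that the closest point of the first tier is
preferred. -/
theorem lintegral_association_mul_loss (hX : IsHomogeneousPPP P lam X)
    (hY : IsHomogeneousPPP P lam' Y) (hXY : IndepFun (fun ω n => X n ω) (fun ω n => Y n ω) P)
    (hlam : 0 < lam) (hlam' : 0 < lam') {A : Set (ℝ × ℝ)}
    (hA : A = {p | p.1 ≤ p.2} ∨ A = {p | p.1 < p.2})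
    {κ s s' : ℝ} (hκ : 0 < κ) (hs : 0 ≤ s) (hs' : 0 ≤ s') :
    ∫⁻ ω, (if (κ ^ 2 * nearestSq (fun n => X n ω), nearestSq fun n => Y n ω) ∈ A then
        loss (s * nearestSq fun n => X n ω) (fun n => X n ω) *
          loss (s' * nearestSq fun n => X n ω) (fun n => Y n ω) else 0) ∂P
      = ENNReal.ofReal (lam / ((1 + s ^ 2) *
          (lam * (1 + tailCoeff s) + κ ^ 2 * lam' * (1 + tailCoeff (s' / κ ^ 2))))) := by
  have hAm : MeasurableSet A := by
    rcases hA with rfl | rfl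
    · exact measurableSet_le measurable_fst measurable_snd
    · exact measurableSet_lt measurable_fst measurable_snd
  have hτ := tailCoeff_nonneg hs
  have hτ' : 0 ≤ tailCoeff (s' / κ ^ 2) := tailCoeff_nonneg (by positivity)
  let f : (ℕ → Plane) → (ℕ → Plane) → ℝ≥0∞ := fun x y =>
    if (κ ^ 2 * nearestSq x, nearestSq y) ∈ A then
      loss (s * nearestSq x) x * loss (s' * nearestSq x) y else 0
  have hf : Measurable (Function.uncurry f) := by
    have ht : Measurable fun p : (ℕ → Plane) × (ℕ → Plane) => nearestSq p.1 :=
      measurable_nearestSq.comp measurable_fst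
    have ht' : Measurable fun p : (ℕ → Plane) × (ℕ → Plane) => nearestSq p.2 :=
      measurable_nearestSq.comp measurable_snd
    have hset : MeasurableSet
        {p : (ℕ → Plane) × (ℕ → Plane) | (κ ^ 2 * nearestSq p.1, nearestSq p.2) ∈ A} :=
      ((ht.const_mul _).prodMk ht') hAm
    exact Measurable.ite hset ((measurable_loss_comp (ht.const_mul s) measurable_fst).mul
      (measurable_loss_comp (ht.const_mul s') measurable_snd)) measurable_const
  have h1 := hXY.lintegral_comp_prod hX.measurable_seq hY.measurable_seq hf
  rw [show ∫⁻ ω, (if (κ ^ 2 * nearestSq (fun n => X n ω), nearestSq fun n => Y n ω) ∈ A then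
        loss (s * nearestSq fun n => X n ω) (fun n => X n ω) *
          loss (s' * nearestSq fun n => X n ω) (fun n => Y n ω) else 0) ∂P
        = ∫⁻ ω, f (fun n => X n ω) (fun n => Y n ω) ∂P from rfl, h1]
  set θ := lam' * Real.pi * (κ ^ 2 * (1 + tailCoeff (s' / κ ^ 2))) with hθ
  have hθ0 : 0 ≤ θ := by positivity
  have h2 : ∀ᵐ ω ∂P, ∫⁻ ω', f (fun n => X n ω) (fun n => Y n ω') ∂P
      = ENNReal.ofReal (Real.exp (-(θ * nearestSq fun n => X n ω))) *
        loss (s * nearestSq fun n => X n ω) (fun n => X n ω) := by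
    filter_upwards [hX.ae_nearestSq_pos] with ω hω
    have h3 := hY.lintegral_indicator_nearestSq hlam' hA hκ hs' hω
    rw [← h3, ← lintegral_mul_const' _ _ (loss_ne_top _ _)]
    refine lintegral_congr fun ω' => ?_
    simp only [f, indicator_apply, mem_ofPred_eq]
    split_ifs with h
    · exact mul_comm _ _
    · rw [zero_mul]
  rw [lintegral_congr_ae h2, hX.lintegral_exp_nearestSq_mul_loss hlam hs hθ0]
  congr 1
  rw [hθ]
  have := Real.pi_pos
  have h4 : 0 < lam * (1 + tailCoeff s) + κ ^ 2 * lam' * (1 + tailCoeff (s' / κ ^ 2)) := by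
    positivity
  have h5 : lam * Real.pi * (1 + tailCoeff s) + lam' * Real.pi * (κ ^ 2 * (1 + tailCoeff (s' / κ ^ 2)))
      = Real.pi * (lam * (1 + tailCoeff s) + κ ^ 2 * lam' * (1 + tailCoeff (s' / κ ^ 2))) := by ring
  rw [h5, mul_left_comm (1 + s ^ 2), mul_comm lam Real.pi, mul_div_mul_left _ _ this.ne']

end

/-! ### Coverage probability for given positions -/

lemma rxPower_four_of_ne_zero {p : ℝ} (hp : 0 ≤ p) (h : ℂ) {x : Plane} (hx : x ≠ 0) :
    rxPower 4 p h x = ENNReal.ofReal (p / (‖x‖ ^ 2) ^ 2) * ‖h‖ₑ ^ 2 := by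
  have h1 : ‖x‖ₑ ^ (-4 : ℝ) = ENNReal.ofReal ((‖x‖ ^ 2) ^ 2)⁻¹ := by
    have hx' : 0 < ‖x‖ := norm_pos_iff.2 hx
    rw [← ofReal_norm, ENNReal.ofReal_rpow_of_pos hx']
    congr 1
    rw [Real.rpow_neg hx'.le, ← pow_mul]
    norm_num
  rw [rxPower, h1, div_eq_mul_inv, ENNReal.ofReal_mul hp]
  ring

/-- Lets ζ and υ be absorbed into the powers, so that both SINRs take the form of `nearestSinr`. -/
lemma rxPower_mul {c p : ℝ} (hc : 0 ≤ c) (α : ℝ) (h : ℂ) (x : Plane) :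
    rxPower α (c * p) h x = ENNReal.ofReal c * rxPower α p h x := by
  rw [rxPower, rxPower, ENNReal.ofReal_mul hc]
  ring

/-- Signal-to-interference-plus-noise ratio of a user served by the closest point of `x`: `p₀` is
the power of the serving station, `p₁` and `p₂` those of the interferers in `x` and in `y`. -/
noncomputable def nearestSinr (p₀ p₁ p₂ noise : ℝ) (x y : ℕ → Plane) (g h : ℕ → ℂ) : ℝ≥0∞ :=
  rxPower 4 p₀ (g (nearest x)) (x (nearest x)) /
    ((∑' n, if n = nearest x then 0 else rxPower 4 p₁ (g n) (x n))
      + (∑' n, rxPower 4 p₂ (h n) (y n)) + ENNReal.ofReal noise)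

/-- Coefficient of an interferer of power `p₁` at `x` relative to a signal of power `p₀` whose
source is at squared distance `t`. -/
lemma ofReal_mul_rxPower {p₀ p₁ δ t : ℝ} (hp₀ : 0 < p₀) (hp₁ : 0 < p₁) (hδ : 0 < δ) (ht : 0 < t)
    (h : ℂ) {x : Plane} (hx : x ≠ 0) :
    ENNReal.ofReal δ * rxPower 4 p₁ h x = ENNReal.ofReal (p₀ / t ^ 2) *
      (ENNReal.ofReal ((√(δ * p₁ / p₀) * t) ^ 2 / (‖x‖ ^ 2) ^ 2) * ‖h‖ₑ ^ 2) := by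
  have hx' : 0 < ‖x‖ := norm_pos_iff.2 hx
  rw [rxPower_four_of_ne_zero hp₁.le h hx, ← mul_assoc, ← mul_assoc, ← ENNReal.ofReal_mul hδ.le,
    ← ENNReal.ofReal_mul (by positivity), mul_pow, Real.sq_sqrt (by positivity)]
  congr 2
  field_simp

section

variable {Ω : Type*} [MeasurableSpace Ω] {P : Measure Ω} [IsProbabilityMeasure P]
  {g h : ℕ → Ω → ℂ}

/-- Dividing by the mean received signal p₀/t² leaves a comparison of one exponential gain with a
weighted sum of independent ones. The prefactor removes the serving point's own factor from the loss
of x. -/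
theorem measure_lt_nearestSinr (hg : ∀ n, Measurable (g n)) (hh : ∀ n, Measurable (h n))
    (hrg : ∀ n, P.map (fun ω => ‖g n ω‖ ^ 2) = expMeasure 1)
    (hrh : ∀ n, P.map (fun ω => ‖h n ω‖ ^ 2) = expMeasure 1)
    (hind : iIndepFun (Sum.elim g h) P) {p₀ p₁ p₂ δ : ℝ} (hp₀ : 0 < p₀) (hp₁ : 0 < p₁)
    (hp₂ : 0 < p₂) (hδ : 0 < δ) {x y : ℕ → Plane} (hx : ∀ n, x n ≠ 0) (hy : ∀ n, y n ≠ 0) :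
    P {ω | ENNReal.ofReal δ <
        nearestSinr p₀ p₁ p₂ 0 x y (fun n => g n ω) fun n => h n ω}
      = ENNReal.ofReal (1 + √(δ * p₁ / p₀) ^ 2) * (loss (√(δ * p₁ / p₀) * nearestSq x) x *
          loss (√(δ * p₂ / p₀) * nearestSq x) y) := by
  set t := nearestSq x with ht
  have ht0 : 0 < t := pow_pos (norm_pos_iff.2 (hx _)) 2
  set s := √(δ * p₁ / p₀) with hs
  set s' := √(δ * p₂ / p₀) with hs'
  set n₀ := nearest x with hn₀
  -- Weight zero keeps the serving channel in the index set without letting it interfere.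
  let a : ℕ ⊕ ℕ → ℝ := Sum.elim (fun n => if n = n₀ then 0 else (s * t) ^ 2 / (‖x n‖ ^ 2) ^ 2)
    fun n => (s' * t) ^ 2 / (‖y n‖ ^ 2) ^ 2
  have ha : ∀ i, 0 ≤ a i := by
    rintro (n | n)
    · simp only [a, Sum.elim_inl]; split_ifs <;> positivity
    · simp only [a, Sum.elim_inr]; positivity
  have hm : ∀ i, Measurable (Sum.elim g h i) := by
    rintro (n | n)
    exacts [hg n, hh n]
  have hray : ∀ i, P.map (fun ω => ‖Sum.elim g h i ω‖ ^ 2) = expMeasure 1 := by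
    rintro (n | n)
    exacts [hrg n, hrh n]
  have key := measure_tsum_gain_lt hm hind hray ha (i₀ := Sum.inl n₀) (by simp [a])
  have hsum : nexp (∑' i, ENNReal.ofReal (Real.log (1 + a i)))
      = ENNReal.ofReal (1 + s ^ 2) * (loss (s * t) x * loss (s' * t) y) := by
    have h1 : shot (s * t) (‖x n₀‖ ^ 2) = ENNReal.ofReal (Real.log (1 + s ^ 2)) := by
      have : ‖x n₀‖ ^ 2 = t := rfl
      rw [this, shot, mul_pow, mul_div_cancel_right₀ _ (by positivity)]
    have h2 : loss (s * t) x = ENNReal.ofReal (1 / (1 + s ^ 2)) *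
        nexp (∑' n, ENNReal.ofReal (Real.log (1 + a (Sum.inl n)))) := by
      rw [loss, ENNReal.tsum_eq_add_tsum_ite n₀, nexp_add, h1, nexp_log_one_add (by positivity)]
      congr 3
      ext n
      by_cases hn : n = n₀
      · simp [a, hn]
      · simp [a, hn, shot]
    have h3 : ENNReal.ofReal (1 + s ^ 2) * ENNReal.ofReal (1 / (1 + s ^ 2)) = 1 := by
      rw [← ENNReal.ofReal_mul (by positivity), mul_one_div_cancel (by positivity),
        ENNReal.ofReal_one]
    rw [ENNReal.summable.tsum_sum ENNReal.summable, nexp_add, h2, ← mul_assoc, ← mul_assoc, h3,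
      one_mul]
    rfl
  rw [← hsum, ← key]
  congr 1
  ext ω
  have hK0 : ENNReal.ofReal (p₀ / t ^ 2) ≠ 0 := by
    rw [Ne, ENNReal.ofReal_eq_zero, not_le]; positivity
  have hS : rxPower 4 p₀ (g n₀ ω) (x n₀) = ENNReal.ofReal (p₀ / t ^ 2) * ‖g n₀ ω‖ₑ ^ 2 :=
    rxPower_four_of_ne_zero hp₀.le _ (hx n₀)
  have hI : ENNReal.ofReal δ * ((∑' n, if n = n₀ then 0 else rxPower 4 p₁ (g n ω) (x n))
      + (∑' n, rxPower 4 p₂ (h n ω) (y n)) + ENNReal.ofReal 0)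
      = ENNReal.ofReal (p₀ / t ^ 2) *
        ∑' i, ENNReal.ofReal (a i) * ‖Sum.elim g h i ω‖ₑ ^ 2 := by
    rw [ENNReal.summable.tsum_sum ENNReal.summable, ENNReal.ofReal_zero, add_zero, mul_add,
      mul_add, ← ENNReal.tsum_mul_left, ← ENNReal.tsum_mul_left, ← ENNReal.tsum_mul_left,
      ← ENNReal.tsum_mul_left]
    congr 1
    · refine tsum_congr fun n => ?_
      by_cases hn : n = n₀
      · simp [a, hn]
      · simp only [a, if_neg hn, Sum.elim_inl]
        exact ofReal_mul_rxPower hp₀ hp₁ hδ ht0 _ (hx n)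
    · exact tsum_congr fun n => ofReal_mul_rxPower hp₀ hp₂ hδ ht0 _ (hy n)
  have hiff := ENNReal.lt_div_iff_mul_lt (a := rxPower 4 p₀ (g n₀ ω) (x n₀)) (c := ENNReal.ofReal δ)
    (b := (∑' n, if n = n₀ then 0 else rxPower 4 p₁ (g n ω) (x n))
      + (∑' n, rxPower 4 p₂ (h n ω) (y n)) + ENNReal.ofReal 0) (Or.inr ENNReal.ofReal_ne_top)
    (Or.inr (ENNReal.ofReal_pos.2 hδ).ne')
  rw [hI, hS, ENNReal.mul_lt_mul_iff_right hK0 ENNReal.ofReal_ne_top] at hiff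
  rw [← hS] at hiff
  exact hiff

end

/-! ### Averaging over the positions -/

lemma measurable_rxPower {α : Type*} [MeasurableSpace α] {g : α → ℂ} {x : α → Plane}
    (hg : Measurable g) (hx : Measurable x) (p : ℝ) :
    Measurable fun a => rxPower 4 p (g a) (x a) := by
  unfold rxPower
  have h1 := hg.enorm
  have h2 := hx.enorm
  fun_prop

lemma measurable_nearestSinr {α : Type*} [MeasurableSpace α] {x y : α → ℕ → Plane}
    {g h : α → ℕ → ℂ} (hx : Measurable x) (hy : Measurable y) (hg : Measurable g)
    (hh : Measurable h) (p₀ p₁ p₂ noise : ℝ) :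
    Measurable fun a => nearestSinr p₀ p₁ p₂ noise (x a) (y a) (g a) (h a) := by
  have hx' : ∀ n, Measurable fun a => x a n := measurable_pi_iff.1 hx
  have hy' : ∀ n, Measurable fun a => y a n := measurable_pi_iff.1 hy
  have hg' : ∀ n, Measurable fun a => g a n := measurable_pi_iff.1 hg
  have hh' : ∀ n, Measurable fun a => h a n := measurable_pi_iff.1 hh
  have hn : Measurable fun a => nearest (x a) := measurable_nearest.comp hx
  have h0 : Measurable fun a => rxPower 4 p₀ (g a (nearest (x a))) (x a (nearest (x a))) :=
    measurable_rxPower (measurable_apply_index hg' hn) (measurable_apply_index hx' hn) p₀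
  have h1 : Measurable fun a => ∑' n, if n = nearest (x a) then 0 else rxPower 4 p₁ (g a n) (x a n) :=
    Measurable.tsum fun n => Measurable.ite
      (measurableSet_eq_fun measurable_const hn) measurable_const
      (measurable_rxPower (hg' n) (hx' n) p₁)
  have h2 : Measurable fun a => ∑' n, rxPower 4 p₂ (h a n) (y a n) :=
    Measurable.tsum fun n => measurable_rxPower (hh' n) (hy' n) p₂
  exact h0.div ((h1.add h2).add_const _)

/-- Joint probability of association with the closest point of the first tier and of coverage. -/
theorem measure_association_inter_coverage {Ω : Type*} [MeasurableSpace Ω] {P : Measure Ω}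
    [IsProbabilityMeasure P] {lam lam' : ℝ} {X Y : ℕ → Ω → Plane} {g h : ℕ → Ω → ℂ}
    (hX : IsHomogeneousPPP P lam X) (hY : IsHomogeneousPPP P lam' Y)
    (hXY : IndepFun (fun ω n => X n ω) (fun ω n => Y n ω) P)
    (hlam : 0 < lam) (hlam' : 0 < lam')
    (hg : ∀ n, Measurable (g n)) (hh : ∀ n, Measurable (h n))
    (hrg : ∀ n, P.map (fun ω => ‖g n ω‖ ^ 2) = expMeasure 1)
    (hrh : ∀ n, P.map (fun ω => ‖h n ω‖ ^ 2) = expMeasure 1)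
    (hind : iIndepFun (Sum.elim g h) P)
    (hpos : IndepFun (fun ω => (fun n => X n ω, fun n => Y n ω))
      (fun ω => (fun n => g n ω, fun n => h n ω)) P)
    {A : Set (ℝ × ℝ)} (hA : A = {p | p.1 ≤ p.2} ∨ A = {p | p.1 < p.2})
    {κ p₀ p₁ p₂ δ : ℝ} (hκ : 0 < κ) (hp₀ : 0 < p₀) (hp₁ : 0 < p₁) (hp₂ : 0 < p₂) (hδ : 0 < δ) :
    P {ω | (κ ^ 2 * nearestSq (fun n => X n ω), nearestSq fun n => Y n ω) ∈ A ∧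
        ENNReal.ofReal δ < nearestSinr p₀ p₁ p₂ 0 (fun n => X n ω) (fun n => Y n ω)
          (fun n => g n ω) fun n => h n ω}
      = ENNReal.ofReal (lam / (lam * (1 + tailCoeff √(δ * p₁ / p₀)) +
          κ ^ 2 * lam' * (1 + tailCoeff (√(δ * p₂ / p₀) / κ ^ 2)))) := by
  classical
  have hAm : MeasurableSet A := by
    rcases hA with rfl | rfl
    · exact measurableSet_le measurable_fst measurable_snd
    · exact measurableSet_lt measurable_fst measurable_snd
  have hU : Measurable fun ω => ((fun n => X n ω, fun n => Y n ω) : (ℕ → Plane) × (ℕ → Plane)) :=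
    hX.measurable_seq.prodMk hY.measurable_seq
  have hV : Measurable fun ω => ((fun n => g n ω, fun n => h n ω) : (ℕ → ℂ) × (ℕ → ℂ)) :=
    (measurable_pi_lambda _ hg).prodMk (measurable_pi_lambda _ hh)
  let E : Set (((ℕ → Plane) × (ℕ → Plane)) × ((ℕ → ℂ) × (ℕ → ℂ))) :=
    {w | (κ ^ 2 * nearestSq w.1.1, nearestSq w.1.2) ∈ A ∧
      ENNReal.ofReal δ < nearestSinr p₀ p₁ p₂ 0 w.1.1 w.1.2 w.2.1 w.2.2}
  have hE : MeasurableSet E := by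
    have m1 : Measurable fun w : ((ℕ → Plane) × (ℕ → Plane)) × ((ℕ → ℂ) × (ℕ → ℂ)) => w.1.1 :=
      measurable_fst.comp measurable_fst
    have m2 : Measurable fun w : ((ℕ → Plane) × (ℕ → Plane)) × ((ℕ → ℂ) × (ℕ → ℂ)) => w.1.2 :=
      measurable_snd.comp measurable_fst
    have m3 : Measurable fun w : ((ℕ → Plane) × (ℕ → Plane)) × ((ℕ → ℂ) × (ℕ → ℂ)) => w.2.1 :=
      measurable_fst.comp measurable_snd
    have m4 : Measurable fun w : ((ℕ → Plane) × (ℕ → Plane)) × ((ℕ → ℂ) × (ℕ → ℂ)) => w.2.2 :=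
      measurable_snd.comp measurable_snd
    exact (((measurable_nearestSq.comp m1).const_mul _).prodMk (measurable_nearestSq.comp m2) hAm).inter
      (measurableSet_lt measurable_const (measurable_nearestSinr m1 m2 m3 m4 _ _ _ _))
  have h1 := hpos.lintegral_comp_prod hU hV (f := fun u v => E.indicator 1 (u, v))
    (measurable_one.indicator hE)
  have h2 : P {ω | (κ ^ 2 * nearestSq (fun n => X n ω), nearestSq fun n => Y n ω) ∈ A ∧
        ENNReal.ofReal δ < nearestSinr p₀ p₁ p₂ 0 (fun n => X n ω) (fun n => Y n ω)
          (fun n => g n ω) fun n => h n ω}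
      = ∫⁻ ω, E.indicator 1 ((fun n => X n ω, fun n => Y n ω), (fun n => g n ω, fun n => h n ω)) ∂P :=
    (lintegral_indicator_one ((hU.prodMk hV) hE)).symm
  set s := √(δ * p₁ / p₀) with hs
  set s' := √(δ * p₂ / p₀) with hs'
  -- Association depends only on the frozen positions, so the channel average is the coverage
  -- probability or zero.
  have h3 : ∀ᵐ ω ∂P, ∫⁻ ω', E.indicator 1
        ((fun n => X n ω, fun n => Y n ω), (fun n => g n ω', fun n => h n ω')) ∂P
      = ENNReal.ofReal (1 + s ^ 2) *
        (if (κ ^ 2 * nearestSq (fun n => X n ω), nearestSq fun n => Y n ω) ∈ A then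
          loss (s * nearestSq fun n => X n ω) (fun n => X n ω) *
          loss (s' * nearestSq fun n => X n ω) (fun n => Y n ω) else 0) := by
    filter_upwards [hX.ae_ne_zero, hY.ae_ne_zero] with ω hx hy
    split_ifs with hAω
    · rw [← measure_lt_nearestSinr hg hh hrg hrh hind hp₀ hp₁ hp₂ hδ hx hy,
        ← lintegral_indicator_one]
      · refine lintegral_congr fun ω' => ?_
        simp only [indicator_apply, E, mem_ofPred_eq, hAω, true_and, Pi.one_apply]
      · exact measurableSet_lt measurable_const (measurable_nearestSinr measurable_const
          measurable_const (measurable_pi_lambda _ hg) (measurable_pi_lambda _ hh) _ _ _ _)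
    · rw [mul_zero, ← lintegral_zero (μ := P)]
      refine lintegral_congr fun ω' => indicator_of_notMem ?_ _
      exact fun hmem => hAω hmem.1
  have hτ := tailCoeff_nonneg (Real.sqrt_nonneg (δ * p₁ / p₀))
  rw [h2, h1, lintegral_congr_ae h3, lintegral_const_mul' _ _ ENNReal.ofReal_ne_top,
    lintegral_association_mul_loss hX hY hXY hlam hlam' hA hκ (Real.sqrt_nonneg _)
      (Real.sqrt_nonneg _), ← ENNReal.ofReal_mul (by positivity)]
  congr 1
  rw [← mul_div_assoc, mul_div_mul_left _ _ (by positivity)]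

/-- The case s = s' = 0 of `lintegral_association_mul_loss`, in which every loss factor is 1. -/
theorem measure_association {Ω : Type*} [MeasurableSpace Ω] {P : Measure Ω}
    [IsProbabilityMeasure P] {lam lam' : ℝ} {X Y : ℕ → Ω → Plane}
    (hX : IsHomogeneousPPP P lam X) (hY : IsHomogeneousPPP P lam' Y)
    (hXY : IndepFun (fun ω n => X n ω) (fun ω n => Y n ω) P)
    (hlam : 0 < lam) (hlam' : 0 < lam')
    {A : Set (ℝ × ℝ)} (hA : A = {p | p.1 ≤ p.2} ∨ A = {p | p.1 < p.2}) {κ : ℝ} (hκ : 0 < κ) :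
    P {ω | (κ ^ 2 * nearestSq (fun n => X n ω), nearestSq fun n => Y n ω) ∈ A}
      = ENNReal.ofReal (lam / (lam + κ ^ 2 * lam')) := by
  classical
  have hAm : MeasurableSet A := by
    rcases hA with rfl | rfl
    · exact measurableSet_le measurable_fst measurable_snd
    · exact measurableSet_lt measurable_fst measurable_snd
  have h := lintegral_association_mul_loss hX hY hXY hlam hlam' hA hκ le_rfl le_rfl
  simp only [zero_mul, loss_zero, mul_one, zero_div] at h
  have h0 : tailCoeff 0 = 0 := by simp [tailCoeff]
  rw [h0, add_zero, mul_one, mul_one, zero_pow two_ne_zero, add_zero, one_mul] at h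
  rw [← h, ← lintegral_indicator_one]
  · rfl
  · exact (((measurable_nearestSq.comp hX.measurable_seq).const_mul _).prodMk
      (measurable_nearestSq.comp hY.measurable_seq)) hAm

/-! ### Conditional coverage probability -/

lemma le_association_iff {κ : ℝ} (hκ : 0 < κ) (x y : ℕ → Plane) :
    κ ^ 2 * nearestSq x ≤ nearestSq y ↔ κ * ‖x (nearest x)‖ ≤ ‖y (nearest y)‖ := by
  rw [nearestSq, nearestSq, ← mul_pow]
  exact pow_le_pow_iff_left₀ (by positivity) (norm_nonneg _) two_ne_zero

lemma lt_association_iff {κ : ℝ} (hκ : 0 < κ) (x y : ℕ → Plane) :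
    κ ^ 2 * nearestSq x < nearestSq y ↔ κ * ‖x (nearest x)‖ < ‖y (nearest y)‖ := by
  rw [nearestSq, nearestSq, ← mul_pow]
  exact pow_lt_pow_iff_left₀ (by positivity) (norm_nonneg _) two_ne_zero

lemma cond_real_apply_of_eq_ofReal {Ω : Type*} [MeasurableSpace Ω] {P : Measure Ω} {s t : Set Ω}
    (hs : MeasurableSet s) {a b : ℝ} (ha : 0 ≤ a) (hb : 0 ≤ b) (hPs : P s = ENNReal.ofReal a)
    (hPst : P (s ∩ t) = ENNReal.ofReal b) : (ProbabilityTheory.cond P s).real t = b / a := by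
  rw [measureReal_def, cond_apply hs, hPs, hPst, ENNReal.toReal_mul, ENNReal.toReal_inv,
    ENNReal.toReal_ofReal ha, ENNReal.toReal_ofReal hb, div_eq_inv_mul]

theorem cond_association_coverage {Ω : Type*} [MeasurableSpace Ω] {P : Measure Ω}
    [IsProbabilityMeasure P] {lam lam' : ℝ} {X Y : ℕ → Ω → Plane} {g h : ℕ → Ω → ℂ}
    (hX : IsHomogeneousPPP P lam X) (hY : IsHomogeneousPPP P lam' Y)
    (hXY : IndepFun (fun ω n => X n ω) (fun ω n => Y n ω) P)
    (hlam : 0 < lam) (hlam' : 0 < lam')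
    (hg : ∀ n, Measurable (g n)) (hh : ∀ n, Measurable (h n))
    (hrg : ∀ n, P.map (fun ω => ‖g n ω‖ ^ 2) = expMeasure 1)
    (hrh : ∀ n, P.map (fun ω => ‖h n ω‖ ^ 2) = expMeasure 1)
    (hind : iIndepFun (Sum.elim g h) P)
    (hpos : IndepFun (fun ω => (fun n => X n ω, fun n => Y n ω))
      (fun ω => (fun n => g n ω, fun n => h n ω)) P)
    {A : Set (ℝ × ℝ)} (hA : A = {p | p.1 ≤ p.2} ∨ A = {p | p.1 < p.2})
    {κ p₀ p₁ p₂ δ : ℝ} (hκ : 0 < κ) (hp₀ : 0 < p₀) (hp₁ : 0 < p₁) (hp₂ : 0 < p₂) (hδ : 0 < δ) :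
    (ProbabilityTheory.cond P
        {ω | (κ ^ 2 * nearestSq (fun n => X n ω), nearestSq fun n => Y n ω) ∈ A}).real
      {ω | ENNReal.ofReal δ < nearestSinr p₀ p₁ p₂ 0 (fun n => X n ω) (fun n => Y n ω)
          (fun n => g n ω) fun n => h n ω}
      = (lam + κ ^ 2 * lam') / (lam * (1 + tailCoeff √(δ * p₁ / p₀)) +
          κ ^ 2 * lam' * (1 + tailCoeff (√(δ * p₂ / p₀) / κ ^ 2))) := by
  have hAm : MeasurableSet A := by
    rcases hA with rfl | rfl
    · exact measurableSet_le measurable_fst measurable_snd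
    · exact measurableSet_lt measurable_fst measurable_snd
  have hτ := tailCoeff_nonneg (Real.sqrt_nonneg (δ * p₁ / p₀))
  have hτ' : 0 ≤ tailCoeff (√(δ * p₂ / p₀) / κ ^ 2) := tailCoeff_nonneg (by positivity)
  have hmeas : MeasurableSet
      {ω | (κ ^ 2 * nearestSq (fun n => X n ω), nearestSq fun n => Y n ω) ∈ A} :=
    (((measurable_nearestSq.comp hX.measurable_seq).const_mul _).prodMk
      (measurable_nearestSq.comp hY.measurable_seq)) hAm
  have hboth := measure_association_inter_coverage hX hY hXY hlam hlam' hg hh hrg hrh hind hpos hA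
    hκ hp₀ hp₁ hp₂ hδ
  refine (cond_real_apply_of_eq_ofReal hmeas (by positivity) (by positivity)
    (measure_association hX hY hXY hlam hlam' hA hκ) hboth).trans ?_
  rw [div_div_div_cancel_left' _ _ hlam.ne']

/-! ### Vanishing noise -/

/-- A strict inequality without noise survives small noise by continuity; if it fails without noise,
adding noise cannot restore it. -/
lemma eventually_lt_div_add_ofReal_iff {δ : ℝ} (hδ : 0 < δ) (S I : ℝ≥0∞) :
    ∀ᶠ noise : ℝ in 𝓝[>] 0, (ENNReal.ofReal δ < S / (I + ENNReal.ofReal noise) ↔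
      ENNReal.ofReal δ < S / (I + ENNReal.ofReal 0)) := by
  have hiff : ∀ J : ℝ≥0∞, ENNReal.ofReal δ < S / J ↔ ENNReal.ofReal δ * J < S := fun J =>
    ENNReal.lt_div_iff_mul_lt (Or.inr ENNReal.ofReal_ne_top) (Or.inr (ENNReal.ofReal_pos.2 hδ).ne')
  simp_rw [hiff]
  by_cases h : ENNReal.ofReal δ * (I + ENNReal.ofReal 0) < S
  · have hlim : Tendsto (fun noise : ℝ => ENNReal.ofReal δ * (I + ENNReal.ofReal noise)) (𝓝[>] 0)
        (𝓝 (ENNReal.ofReal δ * (I + ENNReal.ofReal 0))) := by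
      refine ENNReal.Tendsto.const_mul ?_ (Or.inr ENNReal.ofReal_ne_top)
      exact tendsto_const_nhds.add
        ((ENNReal.continuous_ofReal.tendsto 0).mono_left nhdsWithin_le_nhds)
    filter_upwards [hlim.eventually (gt_mem_nhds h)] with noise hn
    exact iff_of_true hn h
  · refine Eventually.of_forall fun noise => iff_of_false (fun hn => h ?_) h
    refine lt_of_le_of_lt ?_ hn
    rw [ENNReal.ofReal_zero]
    gcongr
    exact zero_le

lemma tendsto_measureReal_lt_nearestSinr {Ω : Type*} [MeasurableSpace Ω] (μ : Measure Ω)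
    [IsFiniteMeasure μ] {x y : Ω → ℕ → Plane} {g h : Ω → ℕ → ℂ} (hx : Measurable x)
    (hy : Measurable y) (hg : Measurable g) (hh : Measurable h) (p₀ p₁ p₂ : ℝ) {δ : ℝ}
    (hδ : 0 < δ) :
    Tendsto (fun noise : ℝ => μ.real {ω | ENNReal.ofReal δ <
        nearestSinr p₀ p₁ p₂ noise (x ω) (y ω) (g ω) (h ω)}) (𝓝[>] 0)
      (𝓝 (μ.real {ω | ENNReal.ofReal δ < nearestSinr p₀ p₁ p₂ 0 (x ω) (y ω) (g ω) (h ω)})) := by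
  have hm : ∀ noise, MeasurableSet {ω | ENNReal.ofReal δ <
      nearestSinr p₀ p₁ p₂ noise (x ω) (y ω) (g ω) (h ω)} := fun noise =>
    measurableSet_lt measurable_const (measurable_nearestSinr hx hy hg hh _ _ _ _)
  refine (ENNReal.tendsto_toReal (measure_ne_top _ _)).comp ?_
  exact tendsto_measure_of_ae_tendsto_indicator_of_isFiniteMeasure _ (hm 0) hm
    (ae_of_all _ fun ω => eventually_lt_div_add_ofReal_iff hδ _ _)

/-! ### Constants and closed forms -/

/-- Γ(n + 1 + y) = y(y + 1)⋯(y + n)Γ(y), and y > 1 makes each factor y + i exceed i + 1. -/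
lemma natFactorial_mul_Gamma_lt {y : ℝ} (hy : 1 < y) (n : ℕ) :
    ((n + 1).factorial : ℝ) * Real.Gamma y < Real.Gamma ((n + 1 : ℕ) + y) := by
  have hΓ : 0 < Real.Gamma y := Real.Gamma_pos_of_pos (by linarith)
  induction n with
  | zero =>
    rw [show ((0 + 1 : ℕ) : ℝ) + y = y + 1 by push_cast; ring, Real.Gamma_add_one (by linarith)]
    simpa using (lt_mul_iff_one_lt_left hΓ).2 hy
  | succ n ih =>
    have hn : (0 : ℝ) < (n + 1 : ℕ) + y := by positivity
    rw [show ((n + 1 + 1 : ℕ) : ℝ) + y = ((n + 1 : ℕ) + y) + 1 by push_cast; ring,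
      Real.Gamma_add_one hn.ne', Nat.factorial_succ, Nat.cast_mul, mul_assoc]
    refine mul_lt_mul'' ?_ ih (by positivity) (by positivity)
    push_cast
    linarith

/-- With L = 2^B and y = N_B/(N_B − 1) > 1, L β(L, y) = L! Γ(y)/Γ(L + y) < 1. -/
lemma quantCoeff_pos {B NB : ℕ} (hNB : 2 ≤ NB) : 0 < quantCoeff B NB := by
  have hNB' : (2 : ℝ) ≤ NB := by exact_mod_cast hNB
  have hy : 1 < (NB : ℝ) / ((NB : ℝ) - 1) := by
    rw [lt_div_iff₀] <;> linarith
  obtain ⟨n, hn⟩ : ∃ n, 2 ^ B = n + 1 := ⟨2 ^ B - 1, (Nat.sub_add_cancel Nat.one_le_two_pow).symm⟩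
  have hn' : (2 : ℝ) ^ B = n + 1 := by exact_mod_cast hn
  have h := natFactorial_mul_Gamma_lt hy n
  push_cast at h
  have hpos : 0 < Real.Gamma ((n : ℝ) + 1 + NB / ((NB : ℝ) - 1)) :=
    Real.Gamma_pos_of_pos (by positivity)
  rw [quantCoeff, sub_pos, ProbabilityTheory.beta, hn', Real.Gamma_nat_eq_factorial, mul_div_assoc',
    div_lt_one hpos, ← mul_assoc]
  rw [Nat.factorial_succ] at h
  exact_mod_cast h

lemma interfCoeff_pos (B NB : ℕ) : 0 < interfCoeff B NB := Real.rpow_pos_of_pos two_pos _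

lemma tailCoeff_sqrt (z : ℝ) : tailCoeff √z = √z * (Real.pi / 2 - Real.arctan √(z⁻¹)) := by
  rw [tailCoeff, one_div, Real.sqrt_inv]

lemma rho_four {x : ℝ} (hx : 0 < x) : rho x 4 = tailCoeff √x := by
  have h1 : x ^ (-2 / 4 : ℝ) = 1 / √x := by
    rw [show (-2 / 4 : ℝ) = -(1 / 2) by norm_num, Real.rpow_neg hx.le,
      ← Real.sqrt_eq_rpow, ← one_div]
  have h2 : x ^ (2 / 4 : ℝ) = √x := by
    rw [show (2 / 4 : ℝ) = 1 / 2 by norm_num, Real.sqrt_eq_rpow]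
  have h3 : ∀ u : ℝ, √x / (1 + u ^ (4 / 2 : ℝ)) = √x * (1 + u ^ 2)⁻¹ := by
    intro u
    rw [show (4 / 2 : ℝ) = (2 : ℕ) by norm_num, Real.rpow_natCast, div_eq_mul_inv]
  rw [rho, h1, h2]
  simp_rw [h3]
  rw [integral_const_mul, integral_Ioi_inv_one_add_sq, tailCoeff]

lemma closedFormF_eq (lamF lamR k PF PR δ : ℝ) :
    closedFormF lamF lamR k PF PR δ = (lamF + k ^ 2 * lamR) /
      (lamF * (1 + tailCoeff √δ) + k ^ 2 * lamR * (1 + tailCoeff √(δ * PR / (k ^ 4 * PF)))) := by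
  rw [tailCoeff_sqrt (δ * PR / (k ^ 4 * PF)), inv_div, tailCoeff, closedFormF]

lemma closedFormR_eq (lamF lamR k PF PR ζ υ δ : ℝ) :
    closedFormR lamF lamR k PF PR ζ υ δ = (lamF + k ^ 2 * lamR) /
      (lamF * (1 + tailCoeff √(δ * k ^ 4 * PF / (ζ * PR))) +
        k ^ 2 * lamR * (1 + tailCoeff √(υ * δ / ζ))) := by
  rw [tailCoeff_sqrt, tailCoeff_sqrt, inv_div, inv_div, closedFormR]

lemma sqrt_div_sq {z k : ℝ} (hk : 0 < k) : √z / k ^ 2 = √(z / k ^ 4) := by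
  have : √(k ^ 4) = k ^ 2 := by
    rw [show k ^ 4 = (k ^ 2) ^ 2 by ring, Real.sqrt_sq (by positivity)]
  rw [Real.sqrt_div' _ (by positivity), this]

/-! ### The two-tier network -/

namespace Network

variable {Ω : Type*} (N : Network Ω)

lemma sinrR_four_eq {ζ υ : ℝ} (hζ : 0 ≤ ζ) (hυ : 0 ≤ υ) (PF PR noise : ℝ) (ω : Ω) :
    N.sinrR 4 PF PR ζ υ noise ω = nearestSinr (ζ * PR) (υ * PR) PF noise (fun n => N.posR n ω)
      (fun n => N.posF n ω) (fun n => N.chR n ω) fun n => N.chF n ω := by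
  rw [nearestSinr, rxPower_mul hζ]
  simp_rw [rxPower_mul hυ]
  rw [sinrR, ← ENNReal.tsum_mul_left, add_comm (∑' n, rxPower 4 PF (N.chF n ω) (N.posF n ω))]
  simp_rw [mul_ite, mul_zero]
  rfl

lemma assocF_eq {k : ℝ} (hk : 0 < k) :
    N.assocF k = {ω | (k ^ 2 * nearestSq (fun n => N.posF n ω), nearestSq fun n => N.posR n ω) ∈
      {p : ℝ × ℝ | p.1 ≤ p.2}} := by
  ext ω
  exact (le_association_iff hk (fun n => N.posF n ω) fun n => N.posR n ω).symm

/-- The negation of k r_x ≤ r_y is k⁻¹ r_y < r_x: the first-tier event with tiers exchanged, k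
inverted and a strict inequality. -/
lemma assocR_eq {k : ℝ} (hk : 0 < k) :
    N.assocR k = {ω | ((k⁻¹) ^ 2 * nearestSq (fun n => N.posR n ω),
      nearestSq fun n => N.posF n ω) ∈ {p : ℝ × ℝ | p.1 < p.2}} := by
  ext ω
  have h := lt_association_iff (inv_pos.2 hk) (fun n => N.posR n ω) fun n => N.posF n ω
  rw [inv_mul_lt_iff₀ hk] at h
  exact not_le.trans h.symm

variable [MeasurableSpace Ω] {N} {P : Measure Ω} {lamF lamR : ℝ}

lemma IsFRAN.tendsto_successF (hN : N.IsFRAN P lamF lamR) (k PF PR : ℝ) {δ : ℝ} (hδ : 0 < δ) :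
    Tendsto (fun noise : ℝ => N.successF P k 4 PF PR noise δ) (𝓝[>] 0)
      (𝓝 (N.successF P k 4 PF PR 0 δ)) :=
  tendsto_measureReal_lt_nearestSinr _ hN.ppp_F.measurable_seq hN.ppp_R.measurable_seq
    (measurable_pi_lambda _ hN.measurable_chF) (measurable_pi_lambda _ hN.measurable_chR) PF PF PR hδ

lemma IsFRAN.tendsto_successR (hN : N.IsFRAN P lamF lamR) (k PF PR : ℝ) {ζ υ δ : ℝ} (hζ : 0 ≤ ζ)
    (hυ : 0 ≤ υ) (hδ : 0 < δ) :
    Tendsto (fun noise : ℝ => N.successR P k 4 PF PR ζ υ noise δ) (𝓝[>] 0)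
      (𝓝 (N.successR P k 4 PF PR ζ υ 0 δ)) := by
  simp_rw [successR, sinrR_four_eq N hζ hυ]
  exact tendsto_measureReal_lt_nearestSinr _ hN.ppp_R.measurable_seq hN.ppp_F.measurable_seq
    (measurable_pi_lambda _ hN.measurable_chR) (measurable_pi_lambda _ hN.measurable_chF) _ _ _ hδ

variable [IsProbabilityMeasure P]

lemma IsFRAN.successF_eq (hN : N.IsFRAN P lamF lamR) (hlamF : 0 < lamF) (hlamR : 0 < lamR)
    {k PF PR δ : ℝ} (hk : 0 < k) (hPF : 0 < PF) (hPR : 0 < PR) (hδ : 0 < δ) :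
    N.successF P k 4 PF PR 0 δ = closedFormF lamF lamR k PF PR δ := by
  have h := cond_association_coverage hN.ppp_F hN.ppp_R hN.tiers_indep hlamF hlamR
    hN.measurable_chF hN.measurable_chR hN.rayleigh_F hN.rayleigh_R hN.ch_indep hN.pos_ch_indep
    (Or.inl rfl) hk hPF hPF hPR hδ
  rw [closedFormF_eq, successF, assocF_eq N hk]
  refine h.trans ?_
  rw [mul_div_cancel_right₀ _ hPF.ne', sqrt_div_sq hk, div_div, mul_comm PF]

lemma IsFRAN.successR_eq (hN : N.IsFRAN P lamF lamR) (hlamF : 0 < lamF) (hlamR : 0 < lamR)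
    {k PF PR ζ υ δ : ℝ} (hk : 0 < k) (hPF : 0 < PF) (hPR : 0 < PR) (hζ : 0 < ζ) (hυ : 0 < υ)
    (hδ : 0 < δ) :
    N.successR P k 4 PF PR ζ υ 0 δ = closedFormR lamF lamR k PF PR ζ υ δ := by
  have hind : iIndepFun (Sum.elim N.chR N.chF) P := by
    have h := hN.ch_indep.precomp (g := Sum.swap) Sum.swap_leftInverse.injective
    have h' : (fun i : ℕ ⊕ ℕ => Sum.elim N.chF N.chR i.swap) = Sum.elim N.chR N.chF := by
      ext i : 1
      cases i <;> rfl
    rw [← h']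
    exact h
  have hpos := hN.pos_ch_indep.comp (measurable_swap (α := ℕ → Plane) (β := ℕ → Plane))
    (measurable_swap (α := ℕ → ℂ) (β := ℕ → ℂ))
  have h := cond_association_coverage hN.ppp_R hN.ppp_F hN.tiers_indep.symm hlamR hlamF
    hN.measurable_chR hN.measurable_chF hN.rayleigh_R hN.rayleigh_F hind hpos
    (Or.inr rfl) (inv_pos.2 hk) (mul_pos hζ hPR) (mul_pos hυ hPR) hPF hδ
  rw [closedFormR_eq, successR, assocR_eq N hk]
  simp_rw [sinrR_four_eq N hζ.le hυ.le]
  refine h.trans ?_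
  have e1 : δ * (υ * PR) / (ζ * PR) = υ * δ / ζ := by field_simp
  have e2 : δ * PF / (ζ * PR) / k⁻¹ ^ 4 = δ * k ^ 4 * PF / (ζ * PR) := by field_simp
  have t1 := tailCoeff_nonneg (Real.sqrt_nonneg (υ * δ / ζ))
  have t2 := tailCoeff_nonneg (Real.sqrt_nonneg (δ * k ^ 4 * PF / (ζ * PR)))
  -- The two fractions differ by a factor k² in numerator and denominator, since the exchanged tiers
  -- carry the weight k⁻² on λ_F.
  rw [sqrt_div_sq (inv_pos.2 hk), e1, e2, div_eq_div_iff (by positivity) (by positivity)]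
  field_simp
  ring

end Network

lemma rhoFormulaF_four_eq {lamF lamR k PF PR δ : ℝ} (hk : 0 < k) (hPF : 0 < PF) (hPR : 0 < PR)
    (hδ : 0 < δ) :
    rhoFormulaF lamF lamR k 4 PF PR δ = closedFormF lamF lamR k PF PR δ := by
  have hk4 : k ^ (4 : ℝ) = k ^ 4 := by exact_mod_cast Real.rpow_natCast k 4
  rw [closedFormF_eq, rhoFormulaF, hk4, rho_four hδ, rho_four (by positivity)]

lemma rhoFormulaR_four_eq {lamF lamR k PF PR ζ υ δ : ℝ} (hk : 0 < k) (hPF : 0 < PF) (hPR : 0 < PR)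
    (hζ : 0 < ζ) (hυ : 0 < υ) (hδ : 0 < δ) :
    rhoFormulaR lamF lamR k 4 PF PR ζ υ δ = closedFormR lamF lamR k PF PR ζ υ δ := by
  have hk4 : k ^ (4 : ℝ) = k ^ 4 := by exact_mod_cast Real.rpow_natCast k 4
  rw [closedFormR_eq, rhoFormulaR, hk4, rho_four (by positivity), rho_four (by positivity)]

theorem corollary1 {Ω : Type*} [MeasurableSpace Ω] (P : Measure Ω) [IsProbabilityMeasure P]
    (N : Network Ω) (lamF lamR k PF PR δ : ℝ) (B NB : ℕ)
    (hlamF : 0 < lamF) (hlamR : 0 < lamR) (hk : 0 < k) (hPF : 0 < PF) (hPR : 0 < PR)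
    (hδ : 0 < δ) (hNB : 2 ≤ NB) (hN : N.IsFRAN P lamF lamR)
    (ζ υ : ℝ) (hζ : ζ = quantCoeff B NB) (hυ : υ = interfCoeff B NB) :
    -- interference-limited network (no noise)
    N.successF P k 4 PF PR 0 δ = closedFormF lamF lamR k PF PR δ ∧
    N.successR P k 4 PF PR ζ υ 0 δ = closedFormR lamF lamR k PF PR ζ υ δ ∧
    -- vanishing noise power
    Tendsto (fun noise : ℝ => N.successF P k 4 PF PR noise δ) (𝓝[>] 0)
      (𝓝 (closedFormF lamF lamR k PF PR δ)) ∧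
    Tendsto (fun noise : ℝ => N.successR P k 4 PF PR ζ υ noise δ) (𝓝[>] 0)
      (𝓝 (closedFormR lamF lamR k PF PR ζ υ δ)) ∧
    -- the expressions in terms of the integral `ρ` take these closed forms
    (∀ x : ℝ, 0 < x → rho x 4 = √x * (Real.pi / 2 - Real.arctan (1 / √x))) ∧
    rhoFormulaF lamF lamR k 4 PF PR δ = closedFormF lamF lamR k PF PR δ ∧
    rhoFormulaR lamF lamR k 4 PF PR ζ υ δ = closedFormR lamF lamR k PF PR ζ υ δ := by
  have hζ0 : 0 < ζ := hζ ▸ quantCoeff_pos hNB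
  have hυ0 : 0 < υ := hυ ▸ interfCoeff_pos B NB
  have hF := hN.successF_eq hlamF hlamR hk hPF hPR hδ
  have hR := hN.successR_eq hlamF hlamR hk hPF hPR hζ0 hυ0 hδ
  exact ⟨hF, hR, hF ▸ hN.tendsto_successF k PF PR hδ,
    hR ▸ hN.tendsto_successR k PF PR hζ0.le hυ0.le hδ, fun x hx => rho_four hx,
    rhoFormulaF_four_eq hk hPF hPR hδ, rhoFormulaR_four_eq hk hPF hPR hζ0 hυ0 hδ⟩
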